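/- Let $K$ be a compact metric space; $C(K)$ denotes the real continuous functions on $K$ with the sup norm, and $B_1(K)$ the set of pointwise limits of uniformly bounded sequences in $C(K)$. Let $DBSC(K)$ be the set of $F:K\to\mathbb R$ for which there are $C<\infty$ and $(f_n)_{n\ge 0}\subseteq C(K)$ with $f_0\equiv 0$, $f_n\to F$ pointwise and $\sum_{n\ge 0}|f_{n+1}(k)-f_n(k)|\le C$ for all $k\in K$; let $|F|_D$ be the infimum of such $C$. Let $B_{1/2}(K)$ be the set of $F\in B_1(K)$ that are uniform limits of sequences in $DBSC(K)$, and $B_{1/4}(K)$ the set of $F\in B_1(K)$ that are uniform limits of sequences $(F_n)\subseteq DBSC(K)$ with $\sup_n|F_n|_D<\infty$. A basic sequence $(e_n)$ in a Banach space is a spreading model of a seminormalized basic sequence $(x_n)$ if for all $k\in\mathbb N$ and $\varepsilon>0$ there is $N$ such that $\bigl|\,\|\sum_{i=1}^k a_ix_{n_i}\|-\|\sum_{i=1}^k a_ie_i\|\,\bigr|<\varepsilon$ whenever $N<n_1<\dots<n_k$ and $a_i\in\mathbb R$, $|a_i|\le 1$. The summing basis $(s_n)$ of (an isomorph of) $c_0$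 is characterized by $\|\sum_i a_is_i\|=\sup_k|\sum_{i=1}^k a_i|$. A convex block subsequence of $(f_n)$ is a sequence $g_n=\sum_{i=p_n+1}^{p_{n+1}}a_if_i$ with $(p_n)$ an increasing sequence of integers, $a_i\ge 0$ and $\sum_{i=p_n+1}^{p_{n+1}}a_i=1$ for every $n$. Theorem B. Let $(f_n)$ be a uniformly bounded sequence in $C(K)$ converging pointwise to $F$ (so $F\in B_1(K)$). (a) If $F\notin B_{1/2}(K)$, then $(f_n)$ has a subsequence that is a seminormalized basic sequence and has a spreading model equivalent to the unit vector basis of $\ell_1$. (b) If $F\in B_{1/4}(K)\setminus C(K)$, then $(f_n)$ has a convex block subsequence that is a seminormalized basic sequence and has a spreading model equivalent to the summing basis of $c_0$. -/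

import Mathlib

open Filter Topology
open scoped ENNReal

namespace BaireSub

/-! ### Classes of Baire-1 functions on a compact metric space -/

section Classes

variable {K : Type*} [TopologicalSpace K] [CompactSpace K]

/-- A sequence in `C(K)` is uniformly bounded. -/
def UniformlyBounded (f : ℕ → C(K, ℝ)) : Prop :=
  ∃ M : ℝ, ∀ n, ‖f n‖ ≤ M

/-- `(f n)` converges pointwise to `F`. -/
def PointwiseLimit (f : ℕ → C(K, ℝ)) (F : K → ℝ) : Prop :=
  ∀ k, Tendsto (fun n => f n k) atTop (𝓝 (F k))

/-- `B₁(K)`: pointwise limits of uniformly bounded sequences of continuous functions. -/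
def B1 (K : Type*) [TopologicalSpace K] [CompactSpace K] : Set (K → ℝ) :=
  {F | ∃ f : ℕ → C(K, ℝ), UniformlyBounded f ∧ PointwiseLimit f F}

/-- `F` is the pointwise limit of a sequence `(f n)` in `C(K)` with `f 0 = 0` and
`∑ |f (n+1) k - f n k| ≤ C` for every `k`. -/
def DBSCWith (F : K → ℝ) (C : ℝ) : Prop :=
  ∃ f : ℕ → C(K, ℝ), f 0 = 0 ∧ PointwiseLimit f F ∧
    ∀ k, Summable (fun n => |f (n + 1) k - f n k|) ∧ ∑' n, |f (n + 1) k - f n k| ≤ C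

/-- `DBSC(K)`: differences of bounded semicontinuous functions. -/
def DBSC (K : Type*) [TopologicalSpace K] [CompactSpace K] : Set (K → ℝ) :=
  {F | ∃ C : ℝ, DBSCWith F C}

/-- The norm `|F|_D` of `DBSC(K)` (only used for `F ∈ DBSC K`). -/
noncomputable def dNorm (F : K → ℝ) : ℝ :=
  sInf {C : ℝ | 0 ≤ C ∧ DBSCWith F C}

/-- `B_{1/2}(K)`: the Baire-1 functions that are uniform limits of functions in `DBSC(K)`. -/
def BHalf (K : Type*) [TopologicalSpace K] [CompactSpace K] : Set (K → ℝ) :=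
  {F | F ∈ B1 K ∧ ∃ G : ℕ → K → ℝ, (∀ n, G n ∈ DBSC K) ∧ TendstoUniformly G F atTop}

/-- `B_{1/4}(K)`: the Baire-1 functions that are uniform limits of `|·|_D`-bounded sequences
in `DBSC(K)`. -/
def BQuarter (K : Type*) [TopologicalSpace K] [CompactSpace K] : Set (K → ℝ) :=
  {F | F ∈ B1 K ∧ ∃ G : ℕ → K → ℝ, (∀ n, G n ∈ DBSC K) ∧
    BddAbove (Set.range fun n => dNorm (G n)) ∧ TendstoUniformly G F atTop}

end Classes

/-! ### Basic sequences and spreading models -/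

section Sequences

variable {X : Type*} [NormedAddCommGroup X] [NormedSpace ℝ X]
variable {Y : Type*} [NormedAddCommGroup Y] [NormedSpace ℝ Y]

/-- `(x n)` is a basic sequence: it is a Schauder basis of its closed linear span. -/
def IsBasicSeq (x : ℕ → X) : Prop :=
  ∃ b : SchauderBasis ℝ (Submodule.span ℝ (Set.range x)).topologicalClosure,
    ∀ n, ((b n : (Submodule.span ℝ (Set.range x)).topologicalClosure) : X) = x n

/-- `(x n)` is seminormalized: `0 < inf ‖x n‖ ≤ sup ‖x n‖ < ∞`. -/
def Seminormalized (x : ℕ → X) : Prop :=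
  ∃ c C : ℝ, 0 < c ∧ ∀ n, c ≤ ‖x n‖ ∧ ‖x n‖ ≤ C

/-- Equivalence of sequences: on finite linear combinations with the same coefficients the
two norms agree up to a constant. -/
def EquivSeq (x : ℕ → X) (y : ℕ → Y) : Prop :=
  ∃ C : ℝ, 0 < C ∧ ∀ (m : ℕ) (a : ℕ → ℝ),
    ‖∑ i ∈ Finset.range m, a i • x i‖ ≤ C * ‖∑ i ∈ Finset.range m, a i • y i‖ ∧
    ‖∑ i ∈ Finset.range m, a i • y i‖ ≤ C * ‖∑ i ∈ Finset.range m, a i • x i‖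

/-- The basic sequence `(e n)` is a spreading model of the seminormalized basic
sequence `(x n)`. -/
def IsSpreadingModel (e : ℕ → Y) (x : ℕ → X) : Prop :=
  Seminormalized x ∧ IsBasicSeq x ∧ IsBasicSeq e ∧
    ∀ (k : ℕ) (ε : ℝ), 0 < ε → ∃ N : ℕ, ∀ n : Fin k → ℕ, StrictMono n → (∀ i, N < n i) →
      ∀ a : Fin k → ℝ, (∀ i, |a i| ≤ 1) →
        |‖∑ i, a i • x (n i)‖ - ‖∑ i, a i • e (i : ℕ)‖| < ε

/-- `(x n)` has a spreading model, in some Banach space, that is equivalent to `(u n)`. -/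
def HasSpreadingModelEquivTo (x : ℕ → X) (u : ℕ → Y) : Prop :=
  ∃ (E : Type) (_ : NormedAddCommGroup E) (_ : NormedSpace ℝ E) (_ : CompleteSpace E)
    (e : ℕ → E), IsSpreadingModel e x ∧ EquivSeq e u

/-- `(g n)` is a convex block subsequence of `(f n)`: `g n` is a convex combination of the
`f i` with `p n ≤ i < p (n + 1)`, for an increasing sequence `(p n)` of indices. -/
def IsConvexBlockSubseq (g f : ℕ → X) : Prop :=
  ∃ (p : ℕ → ℕ) (a : ℕ → ℝ), StrictMono p ∧ (∀ i, 0 ≤ a i) ∧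
    (∀ n, ∑ i ∈ Finset.Ico (p n) (p (n + 1)), a i = 1) ∧
    ∀ n, g n = ∑ i ∈ Finset.Ico (p n) (p (n + 1)), a i • f i

end Sequences

/-- The unit vector basis of `ℓ₁`. -/
noncomputable def ellOneBasis (n : ℕ) : lp (fun _ : ℕ => ℝ) 1 :=
  lp.single 1 n (1 : ℝ)

/-- The summing basis: the sequences `s n = (0, …, 0, 1, 1, …)`, with `n` zeros, in the sup
norm. Their closed span is the space of convergent sequences, an isomorph of `c₀`. -/
noncomputable def summingBasis (n : ℕ) : lp (fun _ : ℕ => ℝ) ∞ :=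
  ⟨fun k => if n ≤ k then 1 else 0, memℓp_infty ⟨1, by
    rintro _ ⟨k, rfl⟩
    dsimp only
    split_ifs <;> simp⟩⟩

/-- The norm that characterizes the summing basis: `‖∑ aᵢ sᵢ‖ = sup_k |∑_{i ≤ k} aᵢ|`. -/
theorem norm_sum_summingBasis (m : ℕ) (a : ℕ → ℝ) :
    ‖∑ i ∈ Finset.range m, a i • summingBasis i‖ =
      ⨆ k : ℕ, |∑ i ∈ Finset.range m with i ≤ k, a i| := by
  rw [lp.norm_eq_ciSup]
  congr 1
  ext k
  rw [Real.norm_eq_abs, lp.coeFn_sum, Finset.sum_apply, Finset.sum_filter]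
  simp [summingBasis]

end BaireSub

/-!
The two parts share a reduction (`exists_subseq_hasSpreadingModelEquivTo`). Let `f n → F` pointwise
in `C(K)`, bounded, with `F` discontinuous. Then `F` is at positive distance from `C(K)`, and a
gliding hump argument on finite norming sets of points extracts a basic subsequence, which moreover
dominates the summing basis: the sums of tail coefficients are controlled by the norm. Iterated
limits along an ultrafilter give a subsequence for which the norms of `k`-term combinations converge
as the terms go to infinity; the limit is a seminorm on finitely supported sequences, whose
completion carries the spreading model. Only estimates for combinations of `k` terms, all of index
at least some `N` that depends on `k`, remain to be proved.

For `F ∉ B_{1/2}`, iterate for `r < s` the derivation that keeps the limit points both of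
`{s ≤ F}` and of `{F ≤ r}`. If for all `r < s` it reached the empty set in finitely many steps, these
two sets would be separated by finite unions of differences of closed sets, and `F` would be a
uniform limit of functions in `DBSC(K)` (`mem_BHalf_of_oscDeriv_eq_empty`). So for some `r < s` no
derivative is empty. Descending the derivatives one term at a time, terms of `f` late enough are
found to be independent in the sense of Rosenthal (`exists_subseq_independent`), and comparing
opposite sign patterns gives the lower `ℓ₁` estimate.

For `F ∈ B_{1/4}`, let `h m` be sequences of uniformly bounded variation whose limits are within
`1 / (m + 1)` of `F`. By Mazur's theorem convex blocks `g` of `f` are almost as close in norm to the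
blocks of `h m`, simultaneously for all `m` (`exists_convex_blocks_near`). Blocks of `h m` are half
differences of bounded monotone sequences, so Abel's inequality gives the upper summing-basis
estimate, with a constant that does not depend on `m`; choosing `m` as the number of terms, it
passes to `g`. The lower estimate is the domination above.
-/

namespace BaireSub

/-! ### Extraction of subsequences and iterated limits -/

/-- Diagonal extraction: if each property `G j` of finite sets of integers holds at `∅` and survives
the insertion of almost every integer, then some subsequence satisfies `G j` on all finite sets of
indices beyond `j`. Taking for `U` an ultrafilter, or just `atTop`, makes this do the work of
Ramsey's theorem. -/
theorem exists_strictMono_of_eventually_insert {U : Filter ℕ} [NeBot U] (hU : U ≤ atTop)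
    (G : ℕ → Finset ℕ → Prop) (h0 : ∀ j, G j ∅)
    (hG : ∀ j s, G j s → ∀ᶠ n in U, G j (insert n s)) :
    ∃ φ : ℕ → ℕ, StrictMono φ ∧ ∀ j (s : Finset ℕ), (∀ i ∈ s, j ≤ i) → G j (s.image φ) := by
  have key : ∀ (N : ℕ) (T : Finset ℕ), ∃ n, (∀ t ∈ T, t < n) ∧
      ∀ j ≤ N, ∀ s ⊆ T, G j s → G j (insert n s) := by
    intro N T
    have h1 : ∀ᶠ n in U, ∀ t ∈ T, t < n :=
      (Filter.eventually_all_finset T).2 fun t _ => hU (eventually_gt_atTop t)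
    have h2 : ∀ᶠ n in U, ∀ j ∈ Finset.range (N + 1), ∀ s ∈ T.powerset,
        G j s → G j (insert n s) := by
      refine (Filter.eventually_all_finset _).2 fun j _ =>
        (Filter.eventually_all_finset _).2 fun s _ => ?_
      by_cases h : G j s
      · exact (hG j s h).mono fun n hn _ => hn
      · exact Eventually.of_forall fun n hn => absurd hn h
    obtain ⟨n, hn1, hn2⟩ := (h1.and h2).exists
    exact ⟨n, hn1, fun j hj s hs => hn2 j (by simp; omega) s (by simpa using hs)⟩
  choose ψ hψ1 hψ2 using key
  let T : ℕ → Finset ℕ := fun N => Nat.rec ∅ (fun N T => insert (ψ N T) T) N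
  have hT : ∀ N, T (N + 1) = insert (ψ N (T N)) (T N) := fun N => rfl
  have hmono : Monotone T := monotone_nat_of_le_succ fun N => by
    rw [hT]; exact Finset.subset_insert _ _
  have hmem : ∀ a b, a < b → ψ a (T a) ∈ T b := fun a b hab =>
    hmono hab (by rw [hT]; exact Finset.mem_insert_self _ _)
  refine ⟨fun N => ψ N (T N), strictMono_nat_of_lt_succ fun N =>
    hψ1 _ _ _ (hmem _ _ N.lt_succ_self), fun j s => ?_⟩
  induction s using Finset.induction_on_max with
  | empty => intro _; simpa using h0 j
  | insert a s ha ih =>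
    intro hs
    rw [Finset.image_insert]
    refine hψ2 a (T a) j (hs a (Finset.mem_insert_self _ _)) _ ?_
      (ih fun i hi => hs i (Finset.mem_insert_of_mem hi))
    intro x hx
    obtain ⟨i, hi, rfl⟩ := Finset.mem_image.1 hx
    exact hmem _ _ (ha i hi)

/-- The iterated limit along `U` of a function of finite sets of integers: the set is enlarged by
`m` further elements, one after the other. -/
noncomputable def iterLim (U : Ultrafilter ℕ) (h : Finset ℕ → ℝ) : ℕ → Finset ℕ → ℝ
  | 0, s => h s
  | m + 1, s => limUnder (U : Filter ℕ) fun n => iterLim U h m (insert n s)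

theorem tendsto_limUnder_of_bounded (U : Ultrafilter ℕ) {u : ℕ → ℝ} {B : ℝ} (hu : ∀ n, |u n| ≤ B) :
    Tendsto u U (𝓝 (limUnder (U : Filter ℕ) u)) ∧ |limUnder (U : Filter ℕ) u| ≤ B := by
  obtain ⟨x, -, hx⟩ := (isCompact_Icc (a := -B) (b := B)).ultrafilter_le_nhds' (U.map u)
    (Filter.mem_map.2 (Filter.univ_mem' fun n => abs_le.1 (hu n)))
  have ht : Tendsto u U (𝓝 (limUnder (U : Filter ℕ) u)) := tendsto_nhds_limUnder ⟨x, hx⟩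
  exact ⟨ht, le_of_tendsto ht.abs (Eventually.of_forall hu)⟩

theorem abs_iterLim_le (U : Ultrafilter ℕ) {h : Finset ℕ → ℝ} {B : ℝ} (hB : ∀ s, |h s| ≤ B)
    (m : ℕ) : ∀ s, |iterLim U h m s| ≤ B := by
  induction m with
  | zero => exact hB
  | succ m ih => exact fun s => (tendsto_limUnder_of_bounded U fun _ => ih _).2

theorem tendsto_iterLim (U : Ultrafilter ℕ) {h : Finset ℕ → ℝ} {B : ℝ} (hB : ∀ s, |h s| ≤ B)
    (m : ℕ) (s : Finset ℕ) :
    Tendsto (fun n => iterLim U h m (insert n s)) U (𝓝 (iterLim U h (m + 1) s)) :=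
  (tendsto_limUnder_of_bounded U fun _ => abs_iterLim_le U hB m _).1

/-- An infinite Ramsey theorem for real colourings: the value on sets of a given cardinality is
pinned, up to `1 / (j + 1)`, near the iterated limit over the empty set. -/
theorem exists_strictMono_almost_constant (H : ℕ → Set (Finset ℕ → ℝ)) (hfin : ∀ j, (H j).Finite)
    (hbdd : ∀ j, ∀ h ∈ H j, ∃ B, ∀ s, |h s| ≤ B) :
    ∃ φ : ℕ → ℕ, StrictMono φ ∧ ∀ j, ∀ h ∈ H j, ∀ s s' : Finset ℕ,
      (∀ i ∈ s, j ≤ i) → (∀ i ∈ s', j ≤ i) → s.card = s'.card → s.card ≤ j →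
      |h (s.image φ) - h (s'.image φ)| < 2 / ((j : ℝ) + 1) := by
  let U : Ultrafilter ℕ := hyperfilter ℕ
  have hU : (U : Filter ℕ) ≤ atTop := by
    rw [← Nat.cofinite_eq_atTop]; exact hyperfilter_le_cofinite
  -- `s` is good when taking the remaining limits from `s` comes close to taking them all from `∅`
  let G : ℕ → Finset ℕ → Prop := fun j s => ∀ h ∈ H j, ∀ k ∈ Finset.range (j + 1), s.card ≤ k →
    |iterLim U h (k - s.card) s - iterLim U h k ∅| < 1 / ((j : ℝ) + 1)
  obtain ⟨φ, hφ, hG⟩ := exists_strictMono_of_eventually_insert hU G (by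
      intro j h _ k _ _
      simp only [Finset.card_empty, Nat.sub_zero, sub_self, abs_zero]
      positivity) (by
      intro j s hs
      refine (Filter.eventually_all_finite (hfin j)).2 fun h hh =>
        (Filter.eventually_all_finset _).2 fun k hk => ?_
      obtain ⟨B, hB⟩ := hbdd j h hh
      have hns : ∀ᶠ n in (U : Filter ℕ), ∀ t ∈ s, t < n :=
        (Filter.eventually_all_finset s).2 fun t _ => hU (eventually_gt_atTop t)
      by_cases hlt : s.card < k
      · have h1 := hs h hh k hk hlt.le
        obtain ⟨m, hm⟩ : ∃ m, k - s.card = m + 1 := ⟨k - s.card - 1, by omega⟩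
        rw [hm] at h1
        have h2 :=
          (((tendsto_iterLim U hB m s).sub_const (iterLim U h k ∅)).abs).eventually_lt_const h1
        filter_upwards [h2, hns] with n hn hn' _
        have hn0 : n ∉ s := fun hmem => lt_irrefl _ (hn' n hmem)
        rw [Finset.card_insert_of_notMem hn0, show k - (s.card + 1) = m by omega]
        exact hn
      · filter_upwards [hns] with n hn' hle
        have hn0 : n ∉ s := fun hmem => lt_irrefl _ (hn' n hmem)
        rw [Finset.card_insert_of_notMem hn0] at hle
        omega)
  refine ⟨φ, hφ, fun j h hh s s' hs hs' hc hj => ?_⟩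
  have e1 : (s.image φ).card = s.card := Finset.card_image_of_injective _ hφ.injective
  have e2 : (s'.image φ).card = s.card := by
    rw [Finset.card_image_of_injective _ hφ.injective, hc]
  have h1 := hG j s hs h hh s.card (by simp; omega) e1.le
  have h2 := hG j s' hs' h hh s.card (by simp; omega) e2.le
  rw [e1, Nat.sub_self] at h1
  rw [e2, Nat.sub_self] at h2
  simp only [iterLim] at h1 h2
  have : 2 / ((j : ℝ) + 1) = 1 / ((j : ℝ) + 1) + 1 / ((j : ℝ) + 1) := by ring
  rw [abs_lt] at *
  constructor <;> linarith [h1.1, h1.2, h2.1, h2.2]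

section Tuples

variable {X : Type*} [NormedAddCommGroup X] [NormedSpace ℝ X]

/-- The elements of `s`, listed increasingly, index the vectors and their ranks in `s` index the
coefficients. -/
theorem sum_image_rank {k : ℕ} {n : Fin k → ℕ} (hn : StrictMono n) (b : ℕ → ℝ) (x : ℕ → X) :
    ∑ j ∈ Finset.univ.image n, b (((Finset.univ.image n).filter (· < j)).card) • x j =
      ∑ i : Fin k, b i • x (n i) := by
  rw [Finset.sum_image fun _ _ _ _ h => hn.injective h]
  refine Finset.sum_congr rfl fun i _ => ?_
  congr 2
  have : (Finset.univ.image n).filter (· < n i) = (Finset.Iio i).image n := by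
    ext m
    simp only [Finset.mem_filter, Finset.mem_image, Finset.mem_univ, true_and, Finset.mem_Iio]
    constructor
    · rintro ⟨⟨l, rfl⟩, hl⟩; exact ⟨l, hn.lt_iff_lt.1 hl, rfl⟩
    · rintro ⟨l, hl, rfl⟩; exact ⟨⟨l, rfl⟩, hn hl⟩
  rw [this, Finset.card_image_of_injective _ hn.injective, Fin.card_Iio]

theorem exists_finite_net (j : ℕ) (ε : ℝ) (hε : 0 < ε) :
    ∃ S : Set (ℕ → ℝ), S.Finite ∧ (∀ b ∈ S, ∀ i, |b i| ≤ 1) ∧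
      ∀ (k : ℕ), k ≤ j → ∀ a : Fin k → ℝ, (∀ i, |a i| ≤ 1) →
        ∃ b ∈ S, ∀ i : Fin k, |a i - b i| ≤ ε := by
  obtain ⟨t, hts, htf, ht⟩ :=
    (isCompact_closedBall (0 : Fin j → ℝ) 1).finite_cover_balls hε
  refine ⟨(fun (c : Fin j → ℝ) (i : ℕ) => if h : i < j then c ⟨i, h⟩ else 0) '' t,
    htf.image _, ?_, ?_⟩
  · rintro _ ⟨c, hc, rfl⟩ i
    have := hts hc
    rw [mem_closedBall_zero_iff] at this
    dsimp only
    split_ifs with h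
    · exact (norm_le_pi_norm c ⟨i, h⟩).trans this
    · simp
  · intro k hk a ha
    have hmem : (fun i : Fin j => if h : (i : ℕ) < k then a ⟨i, h⟩ else 0) ∈
        Metric.closedBall (0 : Fin j → ℝ) 1 := by
      rw [mem_closedBall_zero_iff, pi_norm_le_iff_of_nonneg zero_le_one]
      intro i
      split_ifs with h
      · exact ha _
      · simp
    obtain ⟨c, hc, hac⟩ := Set.mem_iUnion₂.1 (ht hmem)
    refine ⟨_, ⟨c, hc, rfl⟩, fun i => ?_⟩
    rw [Metric.mem_ball, dist_pi_lt_iff hε] at hac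
    have := hac ⟨i, by omega⟩
    simp only [i.2, dif_pos, Real.dist_eq] at this
    simpa [show (i : ℕ) < j by omega] using this.le

theorem abs_norm_sum_sub_norm_sum_le {k : ℕ} {a b : Fin k → ℝ} {δ M : ℝ} (hδ : 0 ≤ δ)
    {y : Fin k → X}
    (hab : ∀ i, |a i - b i| ≤ δ) (hy : ∀ i, ‖y i‖ ≤ M) :
    |‖∑ i, a i • y i‖ - ‖∑ i, b i • y i‖| ≤ k * (δ * M) := by
  refine (abs_norm_sub_norm_le _ _).trans ?_
  rw [← Finset.sum_sub_distrib]
  refine (norm_sum_le _ _).trans ?_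
  have : ∀ i ∈ Finset.univ, ‖a i • y i - b i • y i‖ ≤ δ * M := fun i _ => by
    rw [← sub_smul, norm_smul]
    exact mul_le_mul (hab i) (hy i) (norm_nonneg _) hδ
  simpa using Finset.sum_le_card_nsmul _ _ _ this

/-- A bounded sequence has a subsequence along which the norms of the linear combinations with `k`
given coefficients are Cauchy, uniformly over coefficients in `[-1, 1]`. -/
theorem exists_strictMono_norm_sum_almost_constant {x : ℕ → X} {M : ℝ} (hM : ∀ n, ‖x n‖ ≤ M) :
    ∃ φ : ℕ → ℕ, StrictMono φ ∧ ∀ (k : ℕ) (ε : ℝ), 0 < ε → ∃ N : ℕ, ∀ n n' : Fin k → ℕ,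
      StrictMono n → StrictMono n' → (∀ i, N ≤ n i) → (∀ i, N ≤ n' i) →
      ∀ a : Fin k → ℝ, (∀ i, |a i| ≤ 1) →
        |‖∑ i, a i • x (φ (n i))‖ - ‖∑ i, a i • x (φ (n' i))‖| < ε := by
  have hM0 : 0 ≤ M := (norm_nonneg _).trans (hM 0)
  choose S hSfin hSle hSnet using fun j : ℕ =>
    exists_finite_net j (1 / ((j : ℝ) + 1) ^ 2) (by positivity)
  -- the coefficient of `x l` is given by the rank of `l` in `s`; larger sets get the value `0`, which
  -- keeps the function bounded
  let h : ℕ → (ℕ → ℝ) → Finset ℕ → ℝ := fun j b s =>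
    if s.card ≤ j then ‖∑ l ∈ s, b ((s.filter (· < l)).card) • x l‖ else 0
  obtain ⟨φ, hφ, hc⟩ := exists_strictMono_almost_constant (fun j => h j '' S j)
    (fun j => (hSfin j).image _) (by
      rintro j _ ⟨b, hb, rfl⟩
      refine ⟨j * M, fun s => ?_⟩
      dsimp only [h]
      split_ifs with hs
      · rw [abs_norm]
        refine (norm_sum_le _ _).trans ?_
        have : ∀ l ∈ s, ‖b ((s.filter (· < l)).card) • x l‖ ≤ M := fun l _ => by
          rw [norm_smul]
          simpa using mul_le_mul (hSle j b hb _) (hM l) (norm_nonneg _) zero_le_one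
        refine (Finset.sum_le_card_nsmul _ _ _ this).trans ?_
        rw [nsmul_eq_mul]
        gcongr
      · simp only [abs_zero]; positivity)
  refine ⟨φ, hφ, fun k ε hε => ?_⟩
  obtain ⟨m, hm⟩ := exists_nat_gt ((2 + 2 * M) / ε)
  have hmj : m ≤ max m k := le_max_left _ _
  have hkj : k ≤ max m k := le_max_right _ _
  generalize max m k = j at hmj hkj
  refine ⟨j, fun n n' hn hn' hNn hNn' a ha => ?_⟩
  obtain ⟨b, hb, hab⟩ := hSnet j k hkj a ha
  have e1 := abs_norm_sum_sub_norm_sum_le (a := a) (b := fun i => b i)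
    (y := fun i => x (φ (n i))) (by positivity) hab fun i => hM _
  have e2 := abs_norm_sum_sub_norm_sum_le (a := a) (b := fun i => b i)
    (y := fun i => x (φ (n' i))) (by positivity) hab fun i => hM _
  have card_eq : ∀ n : Fin k → ℕ, StrictMono n → (Finset.univ.image n).card = k := fun n hn => by
    rw [Finset.card_image_of_injective _ hn.injective, Finset.card_univ, Fintype.card_fin]
  have hval : ∀ n : Fin k → ℕ, StrictMono n →
      h j b ((Finset.univ.image n).image φ) = ‖∑ i : Fin k, b i • x (φ (n i))‖ := fun n hn => by
    have hφn : StrictMono (φ ∘ n) := hφ.comp hn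
    rw [Finset.image_image]
    simp only [h]
    rw [if_pos (by rw [card_eq _ hφn]; exact hkj), sum_image_rank hφn]
    rfl
  have e3 := hc j _ ⟨b, hb, rfl⟩ (Finset.univ.image n) (Finset.univ.image n')
    (by simpa using hNn) (by simpa using hNn') (by rw [card_eq n hn, card_eq n' hn'])
    (by rw [card_eq n hn]; exact hkj)
  rw [hval n hn, hval n' hn'] at e3
  have hj0 : (0 : ℝ) < (j : ℝ) + 1 := by positivity
  have e4 : (k : ℝ) * (1 / ((j : ℝ) + 1) ^ 2 * M) ≤ M / ((j : ℝ) + 1) := by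
    have : (k : ℝ) ≤ (j : ℝ) + 1 := by exact_mod_cast hkj.trans j.le_succ
    calc (k : ℝ) * (1 / ((j : ℝ) + 1) ^ 2 * M) ≤ ((j : ℝ) + 1) * (1 / ((j : ℝ) + 1) ^ 2 * M) := by
          gcongr
      _ = M / ((j : ℝ) + 1) := by field_simp
  have e5 : 2 / ((j : ℝ) + 1) + 2 * (M / ((j : ℝ) + 1)) < ε := by
    have h1 : (2 + 2 * M) / ε < (j : ℝ) + 1 :=
      hm.trans_le ((Nat.cast_le.2 hmj).trans (by linarith))
    rw [div_lt_iff₀ hε] at h1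
    rw [show 2 / ((j : ℝ) + 1) + 2 * (M / ((j : ℝ) + 1)) = (2 + 2 * M) / ((j : ℝ) + 1) by ring,
      div_lt_iff₀ hj0]
    linarith
  rw [abs_le] at e1 e2
  rw [abs_lt] at e3 ⊢
  constructor <;> linarith [e1.1, e1.2, e2.1, e2.2, e3.1, e3.2]

end Tuples

/-! ### Basic sequences and spreading models -/

section Abstract

variable {X : Type*} [NormedAddCommGroup X] [NormedSpace ℝ X]
variable {Y : Type*} [NormedAddCommGroup Y] [NormedSpace ℝ Y]

theorem linearIndependent_of_norm_sum_le {x : ℕ → X} (h0 : ∀ n, x n ≠ 0) {C : ℝ}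
    (hC : ∀ m n, m ≤ n → ∀ a : ℕ → ℝ,
      ‖∑ i ∈ Finset.range m, a i • x i‖ ≤ C * ‖∑ i ∈ Finset.range n, a i • x i‖) :
    LinearIndependent ℝ x := by
  rw [linearIndependent_iff'']
  intro s g hg hsum i
  obtain ⟨N, hN⟩ := (insert i s).exists_nat_subset_range
  have hsum' : ∑ i ∈ Finset.range N, g i • x i = 0 := by
    rw [← hsum]
    exact (Finset.sum_subset ((Finset.subset_insert i s).trans hN) fun j _ hj => by
      rw [hg j hj, zero_smul]).symm
  have hzero : ∀ m ≤ N, ∑ i ∈ Finset.range m, g i • x i = 0 := fun m hm => by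
    have := hC m N hm g
    rw [hsum', norm_zero, mul_zero] at this
    exact norm_le_zero_iff.1 this
  have hi : i < N := Finset.mem_range.1 (hN (Finset.mem_insert_self i s))
  have h1 := hzero (i + 1) hi
  rw [Finset.sum_range_succ, hzero i hi.le, zero_add] at h1
  exact (smul_eq_zero.1 h1).resolve_right (h0 i)

/-- Grunblum's criterion: nonzero vectors whose partial-sum projections are uniformly bounded form
a basic sequence. -/
theorem isBasicSeq_of_norm_sum_le {x : ℕ → X} (h0 : ∀ n, x n ≠ 0) {C : ℝ}
    (hC : ∀ m n, m ≤ n → ∀ a : ℕ → ℝ,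
      ‖∑ i ∈ Finset.range m, a i • x i‖ ≤ C * ‖∑ i ∈ Finset.range n, a i • x i‖) :
    IsBasicSeq x := by
  have hli := linearIndependent_of_norm_sum_le h0 hC
  have hC0 : 0 ≤ C := by
    have h := hC 1 1 le_rfl fun _ => 1
    have : 0 < ‖∑ i ∈ Finset.range 1, (1 : ℝ) • x i‖ := by simpa using h0 0
    nlinarith
  set S := Submodule.span ℝ (Set.range x) with hS
  have hxS : ∀ n, x n ∈ S := fun n => Submodule.subset_span ⟨n, rfl⟩
  -- every element of the span is the sum of its coordinates, in increasing order
  have hrepr : ∀ z : S, ∃ N, ∀ n ≥ N, ∑ i ∈ Finset.range n, hli.repr z i • x i = (z : X) := by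
    intro z
    obtain ⟨N, hN⟩ := (hli.repr z).support.exists_nat_subset_range
    refine ⟨N, fun n hn => ?_⟩
    conv_rhs => rw [← hli.linearCombination_repr z]
    rw [Finsupp.linearCombination_apply, Finsupp.sum_of_support_subset _
      (hN.trans (Finset.range_subset_range.2 hn)) _ (by simp)]
  have hpartial : ∀ (z : S) m, ‖∑ i ∈ Finset.range m, hli.repr z i • x i‖ ≤ C * ‖(z : X)‖ := by
    intro z m
    obtain ⟨N, hN⟩ := hrepr z
    have := hC m (max m N) (le_max_left _ _) (hli.repr z)
    rwa [hN _ (le_max_right _ _)] at this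
  have hcoord : ∀ i (z : S), ‖((Finsupp.lapply i : (ℕ →₀ ℝ) →ₗ[ℝ] ℝ) ∘ₗ hli.repr) z‖ ≤
      (2 * C / ‖x i‖) * ‖z‖ := by
    intro i z
    have hxi : 0 < ‖x i‖ := norm_pos_iff.2 (h0 i)
    rw [div_mul_eq_mul_div, le_div_iff₀ hxi, ← norm_smul]
    have e : ((Finsupp.lapply i : (ℕ →₀ ℝ) →ₗ[ℝ] ℝ) ∘ₗ hli.repr) z • x i =
        ∑ j ∈ Finset.range (i + 1), hli.repr z j • x j -
          ∑ j ∈ Finset.range i, hli.repr z j • x j := by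
      rw [Finset.sum_range_succ, add_sub_cancel_left]; rfl
    rw [e]
    refine (norm_sub_le _ _).trans ?_
    have h1 := hpartial z (i + 1)
    have h2 := hpartial z i
    rw [Submodule.coe_norm]
    linarith
  choose g hg _ using fun i => exists_extension_norm_eq S
    (LinearMap.mkContinuous ((Finsupp.lapply i : (ℕ →₀ ℝ) →ₗ[ℝ] ℝ) ∘ₗ hli.repr) _ (hcoord i))
  have hg' : ∀ i (z : S), g i z = hli.repr z i := fun i z => by rw [hg]; rfl
  let Q : ℕ → X →L[ℝ] X := fun n => ∑ i ∈ Finset.range n, (g i).smulRight (x i)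
  have hQ : ∀ n z, Q n z = ∑ i ∈ Finset.range n, g i z • x i := fun n z => by
    simp [Q, _root_.sum_apply]
  have hQS : ∀ n (z : S), Q n z = ∑ i ∈ Finset.range n, hli.repr z i • x i := fun n z => by
    rw [hQ]; simp only [hg']
  have hQbound : ∀ n, ∀ z ∈ S.topologicalClosure, ‖Q n z‖ ≤ C * ‖z‖ := by
    intro n z hz
    have hcl : IsClosed {z : X | ‖Q n z‖ ≤ C * ‖z‖} :=
      isClosed_le (Q n).continuous.norm (continuous_const.mul continuous_norm)
    have hsub : (S : Set X) ⊆ {z : X | ‖Q n z‖ ≤ C * ‖z‖} := fun z hz => by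
      rw [Set.mem_ofPred_eq, hQS n ⟨z, hz⟩]
      exact hpartial ⟨z, hz⟩ n
    exact closure_minimal hsub hcl hz
  have hlim : ∀ z ∈ S.topologicalClosure, Tendsto (fun n => Q n z) atTop (𝓝 z) := by
    intro z hz
    rw [Metric.tendsto_atTop]
    intro ε hε
    obtain ⟨y, hy, hzy⟩ := Metric.mem_closure_iff.1 hz (ε / (C + 2)) (by positivity)
    obtain ⟨N, hN⟩ := hrepr ⟨y, hy⟩
    refine ⟨N, fun n hn => ?_⟩
    have h1 : Q n y = y := by rw [hQS n ⟨y, hy⟩, hN n hn]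
    have h2 : Q n z - z = Q n (z - y) + (y - z) := by rw [map_sub, h1]; abel
    rw [dist_eq_norm, h2]
    have h3 := hQbound n (z - y)
      (S.topologicalClosure.sub_mem hz (S.le_topologicalClosure hy))
    rw [dist_eq_norm] at hzy
    have h4 := norm_add_le (Q n (z - y)) (y - z)
    rw [norm_sub_rev y z] at h4
    have h5 : (C + 1) * ‖z - y‖ < ε := by
      have h6 : (C + 1) * ‖z - y‖ ≤ (C + 1) * (ε / (C + 2)) := by gcongr
      refine h6.trans_lt ?_
      rw [← mul_div_assoc, div_lt_iff₀ (by positivity)]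
      nlinarith
    linarith
  refine ⟨{ basis := fun n => ⟨x n, S.le_topologicalClosure (hxS n)⟩
            coord := fun n => (g n).comp S.topologicalClosure.subtypeL
            ortho := fun i j => ?_
            expansion := fun z => ?_ }, fun n => rfl⟩
  · change g i ((⟨x j, hxS j⟩ : S) : X) = _
    rw [hg', hli.repr_eq_single j ⟨x j, hxS j⟩ rfl]
    rcases eq_or_ne i j with rfl | h
    · simp
    · simp [h]
  · rw [HasSum, SummationFilter.conditional_filter_eq_map_range, tendsto_map'_iff,
      IsEmbedding.subtypeVal.tendsto_nhds_iff]
    refine (hlim z z.2).congr fun n => ?_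
    rw [hQ]
    simp

/-- The completion of the finitely supported sequences for a seminorm. Completing also separates
points, so that no definiteness is needed. -/
theorem exists_banach_of_seminorm (p : Seminorm ℝ (ℕ →₀ ℝ)) :
    ∃ (E : Type) (_ : NormedAddCommGroup E) (_ : NormedSpace ℝ E) (_ : CompleteSpace E)
      (ι : (ℕ →₀ ℝ) →ₗ[ℝ] E), ∀ a, ‖ι a‖ = p a := by
  let i1 : SeminormedAddCommGroup (ℕ →₀ ℝ) := p.toAddGroupSeminorm.toSeminormedAddCommGroup
  let i2 : NormedSpace ℝ (ℕ →₀ ℝ) := ⟨fun c a => (map_smul_eq_mul p c a).le⟩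
  exact ⟨UniformSpace.Completion (ℕ →₀ ℝ), inferInstance, inferInstance, inferInstance,
    (UniformSpace.Completion.toComplₗᵢ (𝕜 := ℝ) (E := ℕ →₀ ℝ)).toLinearMap,
    fun a => UniformSpace.Completion.norm_coe a⟩

/-- If the norms of the linear combinations with given coefficients converge along `x`, and are
eventually equivalent to the norms of the combinations of `u`, then `x` has a spreading model
equivalent to `u`, in the completion of the finitely supported sequences for the limit seminorm. -/
theorem hasSpreadingModelEquivTo_of_estimates {x : ℕ → X} {u : ℕ → Y} (hsn : Seminormalized x)
    (hb : IsBasicSeq x)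
    (hcauchy : ∀ (k : ℕ) (ε : ℝ), 0 < ε → ∃ N : ℕ, ∀ n n' : Fin k → ℕ,
      StrictMono n → StrictMono n' → (∀ i, N ≤ n i) → (∀ i, N ≤ n' i) →
      ∀ a : Fin k → ℝ, (∀ i, |a i| ≤ 1) →
        |‖∑ i, a i • x (n i)‖ - ‖∑ i, a i • x (n' i)‖| < ε)
    (hu0 : ∀ n, u n ≠ 0)
    (hu : ∀ m n, m ≤ n → ∀ a : ℕ → ℝ,
      ‖∑ i ∈ Finset.range m, a i • u i‖ ≤ ‖∑ i ∈ Finset.range n, a i • u i‖)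
    {D : ℝ} (hD0 : 0 < D)
    (hD : ∀ k, ∃ N, ∀ n : ℕ → ℕ, StrictMono n → (∀ i, N ≤ n i) → ∀ a : ℕ → ℝ,
      ‖∑ i ∈ Finset.range k, a i • x (n i)‖ ≤ D * ‖∑ i ∈ Finset.range k, a i • u i‖ ∧
        ‖∑ i ∈ Finset.range k, a i • u i‖ ≤ D * ‖∑ i ∈ Finset.range k, a i • x (n i)‖) :
    HasSpreadingModelEquivTo x u := by
  let T : ℕ → (ℕ →₀ ℝ) →ₗ[ℝ] X := fun N => Finsupp.linearCombination ℝ fun i => x (N + i)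
  let v : (k : ℕ) → (Fin k → ℝ) → (ℕ →₀ ℝ) := fun k a => ∑ i : Fin k, Finsupp.single (i : ℕ) (a i)
  have hTv : ∀ N k (a : Fin k → ℝ), T N (v k a) = ∑ i : Fin k, a i • x (N + i) := fun N k a => by
    simp [T, v, map_sum]
  have hshift : ∀ N k, StrictMono fun i : Fin k => N + (i : ℕ) := fun N k i j hij =>
    Nat.add_lt_add_left hij N
  have hv : ∀ b : ℕ →₀ ℝ, ∃ k, ∃ a : Fin k → ℝ, ∃ c : ℝ, 0 < c ∧ (∀ i, |a i| ≤ 1) ∧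
      b = c • v k a := by
    intro b
    obtain ⟨k, hk⟩ := b.support.exists_nat_subset_range
    set c : ℝ := 1 + ∑ i ∈ Finset.range k, |b i| with hc
    have hc0 : 0 < c := by positivity
    refine ⟨k, fun i => b i / c, c, hc0, fun i => ?_, ?_⟩
    · rw [abs_div, abs_of_pos hc0, div_le_one hc0]
      have : |b i| ≤ ∑ i ∈ Finset.range k, |b i| :=
        Finset.single_le_sum (f := fun i => |b i|) (fun i _ => abs_nonneg _) (Finset.mem_range.2 i.2)
      linarith
    · simp only [v, Finset.smul_sum, Finsupp.smul_single, smul_eq_mul, mul_div_cancel₀ _ hc0.ne']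
      rw [← Finset.sum_range fun i => Finsupp.single i (b i),
        ← Finsupp.sum_of_support_subset b hk (fun i c => Finsupp.single i c) (by simp),
        Finsupp.sum_single]
  have hlim : ∀ b, ∃ l, Tendsto (fun N => ‖T N b‖) atTop (𝓝 l) := by
    intro b
    obtain ⟨k, a, c, hc, ha, rfl⟩ := hv b
    refine cauchySeq_tendsto_of_complete (Metric.cauchySeq_iff.2 fun ε hε => ?_)
    obtain ⟨N, hN⟩ := hcauchy k (ε / c) (by positivity)
    refine ⟨N, fun m hm n hn => ?_⟩
    have := hN (fun i => m + i) (fun i => n + i) (hshift m k) (hshift n k) (fun i => by omega)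
      (fun i => by omega) a ha
    rw [map_smul, map_smul, norm_smul, norm_smul, Real.norm_of_nonneg hc.le, hTv, hTv, Real.dist_eq,
      ← mul_sub, abs_mul, abs_of_pos hc, mul_comm, ← lt_div_iff₀ hc]
    exact this
  choose p hp using hlim
  let P : Seminorm ℝ (ℕ →₀ ℝ) := Seminorm.of p
    (fun a b => le_of_tendsto_of_tendsto' (hp (a + b)) ((hp a).add (hp b)) fun N => by
      rw [map_add]; exact norm_add_le _ _)
    (fun c a => tendsto_nhds_unique (hp (c • a)) (((hp a).const_mul ‖c‖).congr fun N => by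
      rw [map_smul, norm_smul]))
  have hspread : ∀ (k : ℕ) (ε : ℝ), 0 < ε → ∃ N : ℕ, ∀ n : Fin k → ℕ, StrictMono n →
      (∀ i, N ≤ n i) → ∀ a : Fin k → ℝ, (∀ i, |a i| ≤ 1) →
        |‖∑ i, a i • x (n i)‖ - p (v k a)| < ε := by
    intro k ε hε
    obtain ⟨N, hN⟩ := hcauchy k (ε / 2) (by positivity)
    refine ⟨N, fun n hn hnN a ha => ?_⟩
    have h1 : Tendsto (fun m => |‖∑ i, a i • x (n i)‖ - ‖T m (v k a)‖|) atTop
        (𝓝 |‖∑ i, a i • x (n i)‖ - p (v k a)|) := ((hp (v k a)).const_sub _).abs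
    have h2 : |‖∑ i, a i • x (n i)‖ - p (v k a)| ≤ ε / 2 := by
      refine le_of_tendsto h1 ((eventually_ge_atTop N).mono fun m hm => ?_)
      rw [hTv]
      exact (hN n (fun i => m + i) hn (hshift m k) hnN (fun i => by omega) a ha).le
    linarith
  have hequiv : ∀ k (a : ℕ → ℝ), p (v k fun i => a i) ≤ D * ‖∑ i ∈ Finset.range k, a i • u i‖ ∧
      ‖∑ i ∈ Finset.range k, a i • u i‖ ≤ D * p (v k fun i => a i) := by
    intro k a
    obtain ⟨N, hN⟩ := hD k
    have hN' : ∀ m ≥ N, _ := fun m hm => hN (fun i => m + i)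
      (fun i j hij => Nat.add_lt_add_left hij m) (fun i => by omega) a
    have hT : ∀ m, ‖T m (v k fun i => a i)‖ = ‖∑ i ∈ Finset.range k, a i • x (m + i)‖ := fun m => by
      rw [hTv, Finset.sum_range]
    have hpa := (hp (v k fun i => a i)).congr hT
    exact ⟨le_of_tendsto hpa ((eventually_ge_atTop N).mono fun m hm => (hN' m hm).1),
      ge_of_tendsto (hpa.const_mul D) ((eventually_ge_atTop N).mono fun m hm => (hN' m hm).2)⟩
  obtain ⟨E, _, _, _, ι, hι⟩ := exists_banach_of_seminorm P
  have hιv : ∀ k (a : Fin k → ℝ), ι (v k a) = ∑ i, a i • ι (Finsupp.single (i : ℕ) 1) :=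
    fun k a => by
      simp only [v, map_sum, ← map_smul, Finsupp.smul_single, smul_eq_mul, mul_one]
  have hE : ∀ m (a : ℕ → ℝ), ‖∑ i ∈ Finset.range m, a i • ι (Finsupp.single i 1)‖ ≤
      D * ‖∑ i ∈ Finset.range m, a i • u i‖ ∧ ‖∑ i ∈ Finset.range m, a i • u i‖ ≤
      D * ‖∑ i ∈ Finset.range m, a i • ι (Finsupp.single i 1)‖ := by
    intro m a
    rw [Finset.sum_range fun i => a i • ι (Finsupp.single i 1), ← hιv m fun i => a i, hι]
    exact hequiv m a
  refine ⟨E, _, _, ‹_›, fun n => ι (Finsupp.single n 1), ⟨hsn, hb, ?_, ?_⟩, D, hD0, hE⟩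
  · refine isBasicSeq_of_norm_sum_le (C := D * D) (fun n h => hu0 n ?_) fun m n hmn a => ?_
    · have h1 := (hE (n + 1) fun i => if i = n then 1 else 0).2
      simpa [ite_smul, h] using h1
    · calc _ ≤ D * ‖∑ i ∈ Finset.range m, a i • u i‖ := (hE m a).1
        _ ≤ D * ‖∑ i ∈ Finset.range n, a i • u i‖ := by gcongr; exact hu m n hmn a
        _ ≤ D * (D * ‖∑ i ∈ Finset.range n, a i • ι (Finsupp.single i 1)‖) := by
          gcongr; exact (hE n a).2
        _ = _ := by ring
  · intro k ε hε
    obtain ⟨N, hN⟩ := hspread k ε hε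
    refine ⟨N, fun n hn hnN a ha => ?_⟩
    rw [← hιv, hι]
    exact hN n hn (fun i => (hnN i).le) a ha

end Abstract

/-! ### Basic subsequences of sequences with a discontinuous limit -/

section Subsequence

theorem exists_pos_le_abs_sub_of_not_continuous {K : Type*} [TopologicalSpace K] {F : K → ℝ}
    (hF : ¬ Continuous F) :
    ∃ δ > 0, ∀ e : C(K, ℝ), ∃ t, δ ≤ |e t - F t| := by
  by_contra! h
  refine hF ?_
  choose e he using fun n : ℕ => h (1 / ((n : ℝ) + 1)) (by positivity)
  have : TendstoUniformly (fun n t => e n t) F atTop := by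
    rw [Metric.tendstoUniformly_iff]
    intro ε hε
    obtain ⟨N, hN⟩ := exists_nat_one_div_lt hε
    filter_upwards [eventually_ge_atTop N] with n hn t
    rw [dist_comm, Real.dist_eq]
    refine (he n t).trans (lt_of_le_of_lt ?_ hN)
    gcongr
  exact this.continuous (Frequently.of_forall fun n => (e n).continuous)

variable {K : Type*} [TopologicalSpace K] [CompactSpace K]

/-- A discontinuous bounded `F` is at positive distance from `C(K)`, so the sup norm of `e + r F`
controls both `‖e‖` and `|r|`. The supremum need not be attained, but is up to a constant. -/
theorem exists_pos_norm_le_abs_add {F : K → ℝ} (hF : ¬ Continuous F) {M : ℝ}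
    (hM : ∀ t, |F t| ≤ M) :
    ∃ c > 0, ∀ p : C(K, ℝ) × ℝ, ∃ t, c * ‖p‖ ≤ |p.1 t + p.2 * F t| := by
  obtain ⟨δ, hδ, hδF⟩ := exists_pos_le_abs_sub_of_not_continuous hF
  have : Nonempty K := ⟨(hδF 0).choose⟩
  obtain ⟨t0⟩ := this
  have hM0 : 0 ≤ M := (abs_nonneg _).trans (hM t0)
  refine ⟨min (1 / 2) (δ / (2 * (M + 1))), by positivity, fun ⟨e, r⟩ => ?_⟩
  rw [Prod.norm_def]
  simp only [Real.norm_eq_abs]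
  rcases le_or_gt (2 * (M + 1) * |r|) ‖e‖ with h | h
  · obtain ⟨t, ht⟩ : ∃ t, ‖e‖ = |e t| := by
      obtain ⟨t, -, ht⟩ := isCompact_univ.exists_isMaxOn ⟨t0, Set.mem_univ t0⟩
        (e.continuous.abs.continuousOn)
      exact ⟨t, le_antisymm ((e.norm_le (abs_nonneg _)).2 fun s => ht (Set.mem_univ s))
        (e.norm_coe_le_norm t)⟩
    refine ⟨t, ?_⟩
    have h1 : |r| ≤ ‖e‖ := by nlinarith [abs_nonneg r]
    rw [max_eq_left h1]
    have h2 : |r * F t| ≤ |r| * M := by rw [abs_mul]; gcongr; exact hM t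
    have h3 : |e t| - |r * F t| ≤ |e t + r * F t| := by
      have := abs_sub_abs_le_abs_sub (e t) (-(r * F t)); rwa [abs_neg, sub_neg_eq_add] at this
    have h4 : min (1 / 2) (δ / (2 * (M + 1))) * ‖e‖ ≤ 1 / 2 * ‖e‖ := by
      gcongr; exact min_le_left _ _
    nlinarith [abs_nonneg r]
  · have hr : 0 < |r| := by
      by_contra hr
      have : |r| = 0 := le_antisymm (not_lt.1 hr) (abs_nonneg _)
      rw [this, mul_zero] at h
      exact absurd h (not_lt.2 (norm_nonneg _))
    have hr0 : r ≠ 0 := abs_pos.1 hr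
    obtain ⟨t, ht⟩ := hδF (-r⁻¹ • e)
    refine ⟨t, ?_⟩
    have h1 : |e t + r * F t| = |r| * |(-r⁻¹ • e) t - F t| := by
      rw [← abs_mul, ← abs_neg]
      congr 1
      simp only [ContinuousMap.smul_apply, smul_eq_mul]
      field_simp
      ring
    have h2 : max ‖e‖ |r| ≤ 2 * (M + 1) * |r| := max_le h.le (by nlinarith)
    calc min (1 / 2) (δ / (2 * (M + 1))) * max ‖e‖ |r|
        ≤ δ / (2 * (M + 1)) * (2 * (M + 1) * |r|) := by
          gcongr; exact min_le_right _ _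
      _ = |r| * δ := by field_simp
      _ ≤ _ := by rw [h1]; gcongr

/-- Finitely many points of `K` suffice to norm `e + r F`, for `e` in a finite-dimensional space of
continuous functions and `r` a scalar. -/
theorem exists_finset_norming {F : K → ℝ} {c : ℝ} (hc : 0 < c)
    (hF : ∀ p : C(K, ℝ) × ℝ, ∃ t, c * ‖p‖ ≤ |p.1 t + p.2 * F t|)
    (E : Submodule ℝ C(K, ℝ)) [FiniteDimensional ℝ E] :
    ∃ T : Finset K, ∀ e ∈ E, ∀ r : ℝ, ∃ t ∈ T, c / 2 * ‖(e, r)‖ ≤ |e t + r * F t| := by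
  classical
  obtain ⟨t0, -⟩ := hF 0
  have hproper : ProperSpace E := FiniteDimensional.proper ℝ E
  obtain ⟨T, hT⟩ := (isCompact_sphere (0 : E × ℝ) 1).elim_finite_subcover
    (fun t : K => {q : E × ℝ | c / 2 < |(q.1 : C(K, ℝ)) t + q.2 * F t|})
    (fun t => by
      refine isOpen_lt continuous_const (Continuous.abs ?_)
      refine Continuous.add ?_ (continuous_snd.mul continuous_const)
      exact (continuous_eval_const (F := C(K, ℝ)) t).comp
        (continuous_subtype_val.comp continuous_fst))
    (fun q hq => by
      obtain ⟨t, ht⟩ := hF ((q.1 : C(K, ℝ)), q.2)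
      refine Set.mem_iUnion.2 ⟨t, ?_⟩
      have h1 : ‖((q.1 : C(K, ℝ)), q.2)‖ = 1 := by simpa [Prod.norm_def] using hq
      rw [h1, mul_one] at ht
      exact lt_of_lt_of_le (by linarith) ht)
  refine ⟨insert t0 T, fun e he r => ?_⟩
  by_cases h0 : ‖(e, r)‖ = 0
  · exact ⟨t0, Finset.mem_insert_self _ _, by rw [h0, mul_zero]; exact abs_nonneg _⟩
  · have hpos : 0 < ‖(e, r)‖ := lt_of_le_of_ne (norm_nonneg _) (Ne.symm h0)
    set N := ‖(e, r)‖ with hN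
    let q : E × ℝ := (⟨N⁻¹ • e, E.smul_mem _ he⟩, N⁻¹ * r)
    have hq : q ∈ Metric.sphere (0 : E × ℝ) 1 := by
      have h2 : ‖q‖ = ‖N⁻¹ • (e, r)‖ := rfl
      refine mem_sphere_zero_iff_norm.2 (h2.trans ?_)
      rw [norm_smul, ← hN, norm_inv, Real.norm_of_nonneg hpos.le,
        inv_mul_cancel₀ h0]
    obtain ⟨t, ht, hqt⟩ := Set.mem_iUnion₂.1 (hT hq)
    refine ⟨t, Finset.mem_insert_of_mem ht, ?_⟩
    have h3 : (q.1 : C(K, ℝ)) t + q.2 * F t = N⁻¹ * (e t + r * F t) := by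
      change N⁻¹ * e t + N⁻¹ * r * F t = _
      ring
    have h4 : c / 2 < |(q.1 : C(K, ℝ)) t + q.2 * F t| := hqt
    rw [h3, abs_mul, abs_of_pos (inv_pos.2 hpos), inv_mul_eq_div, lt_div_iff₀ hpos] at h4
    exact h4.le

/-- The extraction of a basic sequence. For a linear combination `x` of the chosen subsequence, the
tail beyond `l` acts, on a finite set of points that norms what comes before `l`, almost as a
multiple of `F`, the factor being the sum of the tail coefficients. As `F` is away from `C(K)`, both
the partial sum and this factor are controlled by `‖x‖`. -/
theorem exists_subseq_norm_partial_sum_le {f : ℕ → C(K, ℝ)} {F : K → ℝ} {M : ℝ}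
    (hM : ∀ n, ‖f n‖ ≤ M) (hlim : PointwiseLimit f F) (hF : ¬ Continuous F) :
    ∃ φ : ℕ → ℕ, StrictMono φ ∧ ∃ C : ℝ, 0 < C ∧ ∀ (n : ℕ) (a : ℕ → ℝ), ∀ l ≤ n,
      ‖∑ i ∈ Finset.range l, a i • f (φ i)‖ ≤ C * ‖∑ i ∈ Finset.range n, a i • f (φ i)‖ ∧
      |∑ i ∈ Finset.Ico l n, a i| ≤ C * ‖∑ i ∈ Finset.range n, a i • f (φ i)‖ := by
  classical
  have hMF : ∀ t, |F t| ≤ M := fun t => le_of_tendsto (hlim t).abs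
    (Eventually.of_forall fun n => ((f n).norm_coe_le_norm t).trans (hM n))
  obtain ⟨c, hc, hcF⟩ := exists_pos_norm_le_abs_add hF hMF
  have hE : ∀ N : ℕ, FiniteDimensional ℝ (Submodule.span ℝ (f '' (Finset.range N : Set ℕ))) :=
    fun N => FiniteDimensional.span_of_finite ℝ ((Finset.finite_toSet _).image f)
  choose T hT using fun N : ℕ => exists_finset_norming hc hcF
    (Submodule.span ℝ (f '' (Finset.range N : Set ℕ)))
  have hψ : ∀ m : ℕ, ∃ N, ∀ n ≥ N, ∀ t ∈ (Finset.range (m + 1)).biUnion T,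
      |f n t - F t| ≤ c / 8 * (1 / 2) ^ (m + 1) := fun m => by
    refine eventually_atTop.1 ((Filter.eventually_all_finset _).2 fun t _ => ?_)
    have h1 : Tendsto (fun n => |f n t - F t|) atTop (𝓝 0) := by
      simpa using ((hlim t).sub_const (F t)).abs
    exact (h1.eventually_lt_const (by positivity)).mono fun n hn => hn.le
  choose ψ hψ using hψ
  let m : ℕ → ℕ := fun i => Nat.rec 0 (fun _ m => max m (ψ m) + 1) i
  have hm : ∀ i, m (i + 1) = max (m i) (ψ (m i)) + 1 := fun i => rfl
  have hmono : StrictMono m := strictMono_nat_of_lt_succ fun i => by rw [hm]; omega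
  let φ : ℕ → ℕ := fun i => max (m i) (ψ (m i))
  have hφm : ∀ i, φ i + 1 = m (i + 1) := fun i => rfl
  have hφ : StrictMono φ := strictMono_nat_of_lt_succ fun i => by
    have : m (i + 1) ≤ φ (i + 1) := le_max_left _ _
    have := hφm i
    omega
  refine ⟨φ, hφ, 4 / c, by positivity, fun n a => ?_⟩
  set x := ∑ i ∈ Finset.range n, a i • f (φ i) with hx
  let P : ℕ → C(K, ℝ) × ℝ := fun l =>
    (∑ i ∈ Finset.range l, a i • f (φ i), ∑ i ∈ Finset.Ico l n, a i)
  suffices hP : ∀ l ≤ n, ‖P l‖ ≤ 4 / c * ‖x‖ from fun l hl =>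
    ⟨(norm_fst_le (P l)).trans (hP l hl), (norm_snd_le (P l)).trans (hP l hl)⟩
  -- the largest of the norms `‖P l‖` also bounds the coefficients, hence the error made in
  -- replacing the terms `f (φ i)` of the tail by `F`
  obtain ⟨L, hL, hmax⟩ := Finset.exists_max_image (Finset.range (n + 1)) (fun l => ‖P l‖) 
    (Finset.nonempty_range_iff.2 n.succ_ne_zero)
  have hcoef : ∀ i < n, |a i| ≤ 2 * ‖P L‖ := by
    intro i hi
    have h1 : a i = (P i).2 - (P (i + 1)).2 := by
      simp only [P]; rw [Finset.sum_eq_sum_Ico_succ_bot hi]; ring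
    have h2 := (norm_snd_le (P i)).trans (hmax i (by simp; omega))
    have h3 := (norm_snd_le (P (i + 1))).trans (hmax (i + 1) (by simp; omega))
    rw [h1]
    refine (abs_sub _ _).trans ?_
    rw [Real.norm_eq_abs] at h2 h3
    linarith
  have hLn : L ≤ n := by simpa [Nat.lt_succ_iff] using hL
  have hmem : ∑ i ∈ Finset.range L, a i • f (φ i) ∈
      Submodule.span ℝ (f '' (Finset.range (m L) : Set ℕ)) := by
    refine Submodule.sum_mem _ ?_
    intro i hi
    refine Submodule.smul_mem _ _ ?_
    have h1 : m (i + 1) ≤ m L := hmono.monotone (Finset.mem_range.1 hi)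
    have h2 : φ i ∈ (Finset.range (m L) : Set ℕ) := by
      have := hφm i
      simp only [Finset.coe_range, Set.mem_Iio]
      omega
    exact Submodule.subset_span (Set.mem_image_of_mem f h2)
  obtain ⟨t, ht, hPt⟩ := hT (m L) _ hmem (P L).2
  have herr : ∀ i ∈ Finset.Ico L n, |a i * (f (φ i) t - F t)| ≤
      2 * ‖P L‖ * (c / 8 * (1 / 2) ^ (i + 1)) := by
    intro i hi
    rw [Finset.mem_Ico] at hi
    rw [abs_mul]
    have h1 : |f (φ i) t - F t| ≤ c / 8 * (1 / 2) ^ (m i + 1) := hψ (m i) (φ i) (le_max_right _ _) t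
      (Finset.mem_biUnion.2 ⟨m L, by
        have := hmono.monotone hi.1
        simp only [Finset.mem_range]; omega, ht⟩)
    have h2 : ((1 : ℝ) / 2) ^ (m i + 1) ≤ (1 / 2) ^ (i + 1) :=
      pow_le_pow_of_le_one (by norm_num) (by norm_num) (Nat.succ_le_succ (hmono.id_le i))
    have h3 : |f (φ i) t - F t| ≤ c / 8 * (1 / 2) ^ (i + 1) := h1.trans (by gcongr)
    exact mul_le_mul (hcoef i hi.2) h3 (abs_nonneg _) (by positivity)
  have hgeom : ∑ i ∈ Finset.Ico L n, ((1 : ℝ) / 2) ^ (i + 1) ≤ 1 := by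
    calc ∑ i ∈ Finset.Ico L n, ((1 : ℝ) / 2) ^ (i + 1)
        ≤ ∑ i ∈ Finset.range n, ((1 : ℝ) / 2) ^ (i + 1) := by
          refine Finset.sum_le_sum_of_subset_of_nonneg (fun i hi => ?_) fun i _ _ => by positivity
          simp only [Finset.mem_Ico] at hi
          simp only [Finset.mem_range]; omega
      _ = (∑ i ∈ Finset.range n, ((1 : ℝ) / 2) ^ i) * (1 / 2) := by
          rw [Finset.sum_mul]; simp only [pow_succ]
      _ ≤ 2 * (1 / 2) := by gcongr; exact sum_geometric_two_le n
      _ = 1 := by norm_num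
  have hsplit : (P L).1 t + (P L).2 * F t = x t - ∑ i ∈ Finset.Ico L n, a i * (f (φ i) t - F t) := by
    have h1 : x t = (P L).1 t + ∑ i ∈ Finset.Ico L n, a i * f (φ i) t := by
      simp only [hx, P, ContinuousMap.coe_sum, Finset.sum_apply, ContinuousMap.coe_smul, Pi.smul_apply,
        smul_eq_mul]
      exact (Finset.sum_range_add_sum_Ico _ hLn).symm
    rw [h1]
    simp only [mul_sub, Finset.sum_sub_distrib, P, Finset.sum_mul]
    ring
  have hbound : c / 2 * ‖P L‖ ≤ ‖x‖ + c / 4 * ‖P L‖ := by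
    calc c / 2 * ‖P L‖ ≤ |(P L).1 t + (P L).2 * F t| := hPt
      _ ≤ |x t| + ∑ i ∈ Finset.Ico L n, |a i * (f (φ i) t - F t)| := by
        rw [hsplit]
        exact (abs_sub _ _).trans (by gcongr; exact Finset.abs_sum_le_sum_abs _ _)
      _ ≤ ‖x‖ + ∑ i ∈ Finset.Ico L n, 2 * ‖P L‖ * (c / 8 * (1 / 2) ^ (i + 1)) :=
        add_le_add (x.norm_coe_le_norm t) (Finset.sum_le_sum herr)
      _ = ‖x‖ + c / 4 * ‖P L‖ * ∑ i ∈ Finset.Ico L n, ((1 : ℝ) / 2) ^ (i + 1) := by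
        rw [Finset.mul_sum]; congr 1; exact Finset.sum_congr rfl fun i _ => by ring
      _ ≤ ‖x‖ + c / 4 * ‖P L‖ * 1 := by gcongr
      _ = _ := by ring
  intro l hl
  refine (hmax l (by simp; omega)).trans ?_
  rw [div_mul_eq_mul_div, le_div_iff₀ hc]
  linarith

/-- It suffices to compare linear combinations of `k` terms that come late enough (depending on
`k`) with those of `u`: the extraction of a basic subsequence with a spreading model preserves such
estimates. -/
theorem exists_subseq_hasSpreadingModelEquivTo {Y : Type*} [NormedAddCommGroup Y] [NormedSpace ℝ Y]
    {f : ℕ → C(K, ℝ)} {F : K → ℝ} {M : ℝ}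
    (hM : ∀ n, ‖f n‖ ≤ M) (hlim : PointwiseLimit f F) (hF : ¬ Continuous F)
    {u : ℕ → Y} (hu0 : ∀ n, u n ≠ 0)
    (hu : ∀ m n, m ≤ n → ∀ a : ℕ → ℝ,
      ‖∑ i ∈ Finset.range m, a i • u i‖ ≤ ‖∑ i ∈ Finset.range n, a i • u i‖)
    {D : ℝ} (hD0 : 0 < D)
    (hD : ∀ k, ∃ N, ∀ n : ℕ → ℕ, StrictMono n → (∀ i, N ≤ n i) → ∀ a : ℕ → ℝ,
      ‖∑ i ∈ Finset.range k, a i • f (n i)‖ ≤ D * ‖∑ i ∈ Finset.range k, a i • u i‖ ∧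
        ‖∑ i ∈ Finset.range k, a i • u i‖ ≤ D * ‖∑ i ∈ Finset.range k, a i • f (n i)‖) :
    ∃ φ : ℕ → ℕ, StrictMono φ ∧ HasSpreadingModelEquivTo (fun n => f (φ n)) u := by
  obtain ⟨φ, hφ, hcauchy⟩ := exists_strictMono_norm_sum_almost_constant hM
  obtain ⟨ψ, hψ, C, hC0, hC⟩ := exists_subseq_norm_partial_sum_le (f := fun n => f (φ n))
    (fun n => hM _) (fun t => (hlim t).comp hφ.tendsto_atTop) hF
  have hlow : ∀ i, 1 / C ≤ ‖f (φ (ψ i))‖ := by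
    intro i
    have h1 := (hC (i + 1) (fun j => if j = i then 1 else 0) i i.le_succ).2
    rw [div_le_iff₀' hC0]
    simpa [ite_smul] using h1
  refine ⟨φ ∘ ψ, hφ.comp hψ, hasSpreadingModelEquivTo_of_estimates
    ⟨1 / C, M, by positivity, fun n => ⟨hlow n, hM _⟩⟩
    (isBasicSeq_of_norm_sum_le (C := C) (fun n h => ?_) fun m n hmn a => (hC n a m hmn).1)
    (fun k ε hε => ?_) hu0 hu hD0 fun k => ?_⟩
  · have h1 := hlow n
    simp only [Function.comp] at h
    rw [h, norm_zero] at h1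
    exact absurd h1 (not_le.2 (by positivity))
  · obtain ⟨N, hN⟩ := hcauchy k ε hε
    exact ⟨N, fun n n' hn hn' h h' => hN (ψ ∘ n) (ψ ∘ n') (hψ.comp hn) (hψ.comp hn')
      (fun i => (h i).trans (hψ.id_le _)) fun i => (h' i).trans (hψ.id_le _)⟩
  · obtain ⟨N, hN⟩ := hD k
    exact ⟨N, fun n hn h => hN (φ ∘ ψ ∘ n) ((hφ.comp hψ).comp hn)
      fun i => (h i).trans ((hφ.comp hψ).id_le _)⟩

end Subsequence

/-! ### Convex blocks and Mazur's theorem -/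

section ConvexBlocks

/-- Weights given block by block can be merged into one sequence of weights. -/
theorem isConvexBlockSubseq_of_weights {X : Type*} [NormedAddCommGroup X] [NormedSpace ℝ X]
    {f g : ℕ → X} {p : ℕ → ℕ} (hp : StrictMono p) {w : ℕ → ℕ → ℝ} (hw0 : ∀ n i, 0 ≤ w n i)
    (hw1 : ∀ n, ∑ i ∈ Finset.Ico (p n) (p (n + 1)), w n i = 1)
    (hg : ∀ n, g n = ∑ i ∈ Finset.Ico (p n) (p (n + 1)), w n i • f i) :
    IsConvexBlockSubseq g f := by
  let a : ℕ → ℝ := fun i =>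
    ∑ n ∈ Finset.range (i + 1), if p n ≤ i ∧ i < p (n + 1) then w n i else 0
  have ha : ∀ n, ∀ i ∈ Finset.Ico (p n) (p (n + 1)), a i = w n i := by
    intro n i hi
    rw [Finset.mem_Ico] at hi
    have hn : n ∈ Finset.range (i + 1) := by
      have := hp.id_le n
      simp only [id] at this
      simp only [Finset.mem_range]; omega
    simp only [a]
    rw [Finset.sum_eq_single_of_mem n hn, if_pos hi]
    intro m _ hmn
    refine if_neg fun hm => ?_
    rcases lt_or_gt_of_ne hmn with h | h
    · have := hp.monotone (show m + 1 ≤ n from h); omega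
    · have := hp.monotone (show n + 1 ≤ m from h); omega
  refine ⟨p, a, hp, fun i => Finset.sum_nonneg fun n _ => ?_, fun n => ?_, fun n => ?_⟩
  · split_ifs
    exacts [hw0 n i, le_rfl]
  · rw [Finset.sum_congr rfl (ha n), hw1]
  · rw [hg]
    exact Finset.sum_congr rfl fun i hi => by rw [ha n i hi]

theorem IsConvexBlockSubseq.comp_strictMono {X : Type*} [NormedAddCommGroup X] [NormedSpace ℝ X]
    {f g : ℕ → X} (h : IsConvexBlockSubseq g f) {φ : ℕ → ℕ} (hφ : StrictMono φ) :
    IsConvexBlockSubseq (fun n => g (φ n)) f := by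
  obtain ⟨p, a, hp, ha0, ha1, hg⟩ := h
  have hsub : ∀ n, Finset.Ico (p (φ n)) (p (φ n + 1)) ⊆ Finset.Ico (p (φ n)) (p (φ (n + 1))) :=
    fun n => Finset.Ico_subset_Ico_right (hp.monotone (hφ n.lt_succ_self))
  have hzero : ∀ n, ∀ i ∈ Finset.Ico (p (φ n)) (p (φ (n + 1))),
      i ∉ Finset.Ico (p (φ n)) (p (φ n + 1)) → ¬ i < p (φ n + 1) := fun n i hi hi' h =>
    hi' (Finset.mem_Ico.2 ⟨(Finset.mem_Ico.1 hi).1, h⟩)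
  refine isConvexBlockSubseq_of_weights (hp.comp hφ)
    (w := fun n i => if i < p (φ n + 1) then a i else 0)
    (fun n i => ?_) (fun n => ?_) fun n => ?_
  · split_ifs
    exacts [ha0 i, le_rfl]
  · rw [← ha1 (φ n)]
    refine (Finset.sum_subset_zero_on_sdiff (hsub n) (fun i hi => ?_) fun i hi => ?_).symm
    · rw [Finset.mem_sdiff] at hi; exact if_neg (hzero n i hi.1 hi.2)
    · rw [if_pos (Finset.mem_Ico.1 hi).2]
  · rw [hg]
    refine Finset.sum_subset_zero_on_sdiff (hsub n) (fun i hi => ?_) fun i hi => ?_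
    · rw [Finset.mem_sdiff] at hi; rw [if_neg (hzero n i hi.1 hi.2), zero_smul]
    · rw [if_pos (Finset.mem_Ico.1 hi).2]

variable {K : Type*} [MetricSpace K] [CompactSpace K]

/-- Bounded convergence for a positive functional, through its Riesz measure. -/
theorem tendsto_of_nonneg_functional {v : ℕ → C(K, ℝ)} {M : ℝ} (hM : ∀ n, ‖v n‖ ≤ M)
    (hlim : ∀ t, Tendsto (fun n => v n t) atTop (𝓝 0)) (L : C(K, ℝ) →ₗ[ℝ] ℝ)
    (hL : ∀ g : C(K, ℝ), (∀ t, 0 ≤ g t) → 0 ≤ L g) :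
    Tendsto (fun n => L (v n)) atTop (𝓝 0) := by
  borelize K
  let L' : CompactlySupportedContinuousMap K ℝ →ₚ[ℝ] ℝ := PositiveLinearMap.mk₀
    { toFun := fun g => L g.toContinuousMap
      map_add' := fun g h => L.map_add g.toContinuousMap h.toContinuousMap
      map_smul' := fun c g => L.map_smul c g.toContinuousMap }
    (fun g hg => hL _ fun t => hg t)
  have hrep : ∀ g : C(K, ℝ), L g = ∫ t, g t ∂(RealRMK.rieszMeasure L') := fun g =>
    (RealRMK.integral_rieszMeasure L' (CompactlySupportedContinuousMap.continuousMapEquiv g)).symm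
  simp only [hrep]
  have := MeasureTheory.tendsto_integral_of_dominated_convergence
    (μ := RealRMK.rieszMeasure L') (F := fun n t => v n t) (f := fun _ => (0 : ℝ)) (fun _ => M)
    (fun n => (v n).continuous.aestronglyMeasurable) (MeasureTheory.integrable_const M)
    (fun n => Eventually.of_forall fun t => ((v n).norm_coe_le_norm t).trans (hM n))
    (Eventually.of_forall hlim)
  simpa using this

/-- Mazur's theorem for bounded sequences converging pointwise to `0`, in the one-sided form: some
convex combination of a tail is less than `ε` everywhere. Otherwise the convex hull of the tail is
separated from `{g | g < ε}` by a functional, which is then positive, against bounded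
convergence. -/
theorem exists_convex_combination_lt {v : ℕ → C(K, ℝ)} {M : ℝ} (hM : ∀ n, ‖v n‖ ≤ M)
    (hlim : ∀ t, Tendsto (fun n => v n t) atTop (𝓝 0)) {ε : ℝ} (hε : 0 < ε) (N : ℕ) :
    ∃ N' > N, ∃ w : ℕ → ℝ, (∀ i, 0 ≤ w i) ∧ ∑ i ∈ Finset.Ico N N', w i = 1 ∧
      ∀ t, ∑ i ∈ Finset.Ico N N', w i * v i t < ε := by
  let S : Set (ℕ →₀ ℝ) := {w | (∀ i, 0 ≤ w i) ∧ (∀ i < N, w i = 0) ∧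
    Finsupp.linearCombination ℝ (fun _ : ℕ => (1 : ℝ)) w = 1}
  have hS : Convex ℝ S := by
    rintro w ⟨h0, hN, h1⟩ w' ⟨h0', hN', h1'⟩ a b ha hb hab
    refine ⟨fun i => ?_, fun i hi => ?_, ?_⟩
    · have := h0 i; have := h0' i
      simp only [Finsupp.coe_add, Finsupp.coe_smul, Pi.add_apply, Pi.smul_apply, smul_eq_mul]
      positivity
    · simp [hN i hi, hN' i hi]
    · rw [map_add, map_smul, map_smul, h1, h1', smul_eq_mul, smul_eq_mul, mul_one, mul_one, hab]
  let A : Set C(K, ℝ) := {g | ∀ t, g t < ε}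
  have hAopen : IsOpen A := by
    have hA : A = {g : C(K, ℝ) | Set.MapsTo g Set.univ (Set.Iio ε)} := by
      ext g; simp [A, Set.MapsTo]
    rw [hA]
    exact ContinuousMap.isOpen_setOfPred_mapsTo isCompact_univ isOpen_Iio
  have hAconv : Convex ℝ A := by
    intro g hg h hh a b ha hb hab t
    exact (convex_Iio ε) (hg t) (hh t) ha hb hab
  by_cases hdisj : Disjoint A (Finsupp.linearCombination ℝ v '' S)
  · exfalso
    obtain ⟨L, u, hLA, hLB⟩ := geometric_hahn_banach_open hAconv hAopen
      (hS.linear_image (Finsupp.linearCombination ℝ v)) hdisj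
    have hu : 0 < u := by simpa using hLA 0 fun t => hε
    have hpos : ∀ g : C(K, ℝ), (∀ t, 0 ≤ g t) → 0 ≤ L g := by
      intro g hg
      by_contra! hneg
      have h1 := hLA ((u / L g) • g) fun t => by
        have : u / L g * g t ≤ 0 :=
          mul_nonpos_of_nonpos_of_nonneg (div_nonpos_of_nonneg_of_nonpos hu.le hneg.le) (hg t)
        exact this.trans_lt hε
      rw [map_smul, smul_eq_mul, div_mul_cancel₀ _ hneg.ne] at h1
      exact lt_irrefl _ h1
    have ht := tendsto_of_nonneg_functional hM hlim L.toLinearMap hpos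
    refine absurd (ge_of_tendsto ht ((eventually_ge_atTop N).mono fun n hn => hLB (v n)
      ⟨Finsupp.single n 1, ⟨fun i => ?_, fun i hi => ?_, by simp⟩, by simp⟩)) (not_le.2 hu)
    · rw [Finsupp.single_apply]; split_ifs <;> norm_num
    · rw [Finsupp.single_apply, if_neg (by omega)]
  · obtain ⟨_, hgA, w, ⟨hw0, hwN, hw1⟩, rfl⟩ := Set.not_disjoint_iff.1 hdisj
    obtain ⟨N', hN'⟩ := w.support.exists_nat_subset_range
    have hsupp : w.support ⊆ Finset.Ico N (max N' (N + 1)) := fun i hi => by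
      have h1 := Finset.mem_range.1 (hN' hi)
      have h2 : N ≤ i := by
        by_contra! h
        exact Finsupp.mem_support_iff.1 hi (hwN i h)
      rw [Finset.mem_Ico]
      omega
    refine ⟨max N' (N + 1), by omega, w, hw0, ?_, fun t => ?_⟩
    · rw [Finsupp.linearCombination_apply, Finsupp.sum_of_support_subset _ hsupp _ (by simp)] at hw1
      simpa using hw1
    · have h1 := hgA t
      rw [Finsupp.linearCombination_apply, Finsupp.sum_of_support_subset _ hsupp _ (by simp)] at h1
      simpa [ContinuousMap.coe_sum] using h1

end ConvexBlocks

/-! ### The summing basis -/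

section SummingBasis

theorem filter_le_range (m k : ℕ) :
    (Finset.range m).filter (· ≤ k) = Finset.range (min m (k + 1)) := by
  ext i; simp only [Finset.mem_filter, Finset.mem_range]; omega

theorem abs_sum_le_norm_sum_summingBasis (a : ℕ → ℝ) {l m : ℕ} (hl : l ≤ m) :
    |∑ i ∈ Finset.range l, a i| ≤ ‖∑ i ∈ Finset.range m, a i • summingBasis i‖ := by
  rcases l with _ | l
  · simp
  rw [norm_sum_summingBasis]
  have hbdd : BddAbove (Set.range fun k : ℕ => |∑ i ∈ Finset.range m with i ≤ k, a i|) := by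
    refine ⟨∑ i ∈ Finset.range m, |a i|, ?_⟩
    rintro _ ⟨k, rfl⟩
    exact (Finset.abs_sum_le_sum_abs _ _).trans
      (Finset.sum_le_sum_of_subset_of_nonneg (Finset.filter_subset _ _) fun _ _ _ => abs_nonneg _)
  have h := le_ciSup hbdd l
  simp only [filter_le_range] at h ⊢
  rwa [min_eq_right hl] at h

theorem norm_sum_summingBasis_le {a : ℕ → ℝ} {m : ℕ} {A : ℝ}
    (h : ∀ l ≤ m, |∑ i ∈ Finset.range l, a i| ≤ A) :
    ‖∑ i ∈ Finset.range m, a i • summingBasis i‖ ≤ A := by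
  rw [norm_sum_summingBasis]
  exact ciSup_le fun k => by rw [filter_le_range]; exact h _ (min_le_left _ _)

theorem summingBasis_ne_zero (n : ℕ) : summingBasis n ≠ 0 := fun h => by
  have h1 := congrArg (fun x : lp (fun _ : ℕ => ℝ) ∞ => x n) h
  simp [summingBasis] at h1

/-- Abel's inequality, for the partial sums of `a` and a monotone sequence `z`. -/
theorem abs_sum_mul_sub_le {a z : ℕ → ℝ} (hz : Monotone z) {A : ℝ} (k : ℕ)
    (hA : ∀ l ≤ k, |∑ i ∈ Finset.range l, a i| ≤ A) :
    |∑ i ∈ Finset.range k, a i * z i - (∑ i ∈ Finset.range k, a i) * z k| ≤ A * (z k - z 0) := by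
  induction k with
  | zero => simp
  | succ k ih =>
    have h1 := ih fun l hl => hA l (hl.trans k.le_succ)
    have h2 : |(∑ i ∈ Finset.range (k + 1), a i) * (z k - z (k + 1))| ≤ A * (z (k + 1) - z k) := by
      rw [abs_mul, abs_sub_comm, abs_of_nonneg (sub_nonneg.2 (hz k.le_succ))]
      exact mul_le_mul_of_nonneg_right (hA _ le_rfl) (sub_nonneg.2 (hz k.le_succ))
    have h3 : ∑ i ∈ Finset.range (k + 1), a i * z i -
        (∑ i ∈ Finset.range (k + 1), a i) * z (k + 1) =
        (∑ i ∈ Finset.range k, a i * z i - (∑ i ∈ Finset.range k, a i) * z k) +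
          (∑ i ∈ Finset.range (k + 1), a i) * (z k - z (k + 1)) := by
      simp only [Finset.sum_range_succ]; ring
    rw [h3]
    refine (abs_add_le _ _).trans ((add_le_add h1 h2).trans (le_of_eq (by ring)))

theorem abs_sum_mul_le_of_monotone {a z : ℕ → ℝ} (hz : Monotone z) {A B : ℝ} (hz0 : ∀ i, 0 ≤ z i)
    (hzB : ∀ i, z i ≤ B) (k : ℕ) (hA : ∀ l ≤ k, |∑ i ∈ Finset.range l, a i| ≤ A) :
    |∑ i ∈ Finset.range k, a i * z i| ≤ 2 * A * B := by
  have hA0 : 0 ≤ A := (abs_nonneg _).trans (hA 0 k.zero_le)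
  have h1 := abs_sum_mul_sub_le hz k hA
  have h2 : |(∑ i ∈ Finset.range k, a i) * z k| ≤ A * B := by
    rw [abs_mul, abs_of_nonneg (hz0 k)]
    exact mul_le_mul (hA k le_rfl) (hzB k) (hz0 k) hA0
  have h3 : A * (z k - z 0) ≤ A * B :=
    mul_le_mul_of_nonneg_left (by linarith [hz0 0, hzB k]) hA0
  have h4 := abs_sub_abs_le_abs_sub (∑ i ∈ Finset.range k, a i * z i)
    ((∑ i ∈ Finset.range k, a i) * z k)
  linarith

end SummingBasis

/-! ### Averages over successive blocks -/

section Averages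

theorem average_mem_Icc {s : Finset ℕ} {w z : ℕ → ℝ} (hw : ∀ i, 0 ≤ w i) (h1 : ∑ i ∈ s, w i = 1)
    {b c : ℝ} (hz : ∀ i ∈ s, z i ∈ Set.Icc b c) : ∑ i ∈ s, w i * z i ∈ Set.Icc b c := by
  simpa using (convex_Icc b c).sum_mem (fun i _ => hw i) h1 hz

theorem monotone_average {p : ℕ → ℕ} {w : ℕ → ℕ → ℝ} (hw0 : ∀ n i, 0 ≤ w n i)
    (hw1 : ∀ n, ∑ i ∈ Finset.Ico (p n) (p (n + 1)), w n i = 1) {z : ℕ → ℝ} (hz : Monotone z) :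
    Monotone fun j => ∑ i ∈ Finset.Ico (p j) (p (j + 1)), w j i * z i := by
  refine monotone_nat_of_le_succ fun j => ?_
  have h1 := (average_mem_Icc (hw0 j) (hw1 j) (b := z (p j)) (c := z (p (j + 1))) fun i hi =>
    ⟨hz (Finset.mem_Ico.1 hi).1, hz (Finset.mem_Ico.1 hi).2.le⟩).2
  have h2 := (average_mem_Icc (hw0 (j + 1)) (hw1 (j + 1)) (b := z (p (j + 1)))
    (c := z (p (j + 1 + 1))) fun i hi =>
    ⟨hz (Finset.mem_Ico.1 hi).1, hz (Finset.mem_Ico.1 hi).2.le⟩).1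
  exact h1.trans h2

/-- Block averages of a sequence of bounded variation satisfy an upper summing-basis estimate: the
sequence is half the difference of the bounded monotone sequences `V + h` and `V - h`, where `V`
is its variation, and block averages of a monotone sequence are monotone. -/
theorem abs_sum_mul_average_le {p : ℕ → ℕ} {w : ℕ → ℕ → ℝ} (hw0 : ∀ n i, 0 ≤ w n i)
    (hw1 : ∀ n, ∑ i ∈ Finset.Ico (p n) (p (n + 1)), w n i = 1) {h : ℕ → ℝ} {C : ℝ} (h0 : h 0 = 0)
    (hC : ∀ n, ∑ l ∈ Finset.range n, |h (l + 1) - h l| ≤ C) {n : ℕ → ℕ} (hn : StrictMono n)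
    {a : ℕ → ℝ} {A : ℝ} (k : ℕ) (hA : ∀ l ≤ k, |∑ i ∈ Finset.range l, a i| ≤ A) :
    |∑ j ∈ Finset.range k, a j * ∑ i ∈ Finset.Ico (p (n j)) (p (n j + 1)), w (n j) i * h i| ≤
      4 * A * C := by
  set V : ℕ → ℝ := fun n => ∑ l ∈ Finset.range n, |h (l + 1) - h l| with hV
  have hVs : ∀ i, V (i + 1) = V i + |h (i + 1) - h i| := fun i => Finset.sum_range_succ _ _
  have hmono : ∀ σ : ℝ, |σ| = 1 → Monotone fun i => V i + σ * h i := fun σ hσ =>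
    monotone_nat_of_le_succ fun i => by
      have h1 : |σ * (h (i + 1) - h i)| = |h (i + 1) - h i| := by rw [abs_mul, hσ, one_mul]
      have h2 := neg_abs_le (σ * (h (i + 1) - h i))
      rw [h1] at h2
      rw [hVs]
      linarith
  have hpos : ∀ σ : ℝ, |σ| = 1 → ∀ i, 0 ≤ V i + σ * h i := fun σ hσ i => by
    have := hmono σ hσ i.zero_le
    simpa [hV, h0] using this
  have hle : ∀ σ : ℝ, |σ| = 1 → ∀ i, V i + σ * h i ≤ 2 * C := fun σ hσ i => by
    have h1 := hpos (-σ) (by rwa [abs_neg]) i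
    have h2 := hC i
    change V i ≤ C at h2
    linarith
  have key : ∀ σ : ℝ, |σ| = 1 → |∑ j ∈ Finset.range k, a j *
      ∑ i ∈ Finset.Ico (p (n j)) (p (n j + 1)), w (n j) i * (V i + σ * h i)| ≤ 2 * A * (2 * C) :=
    fun σ hσ => abs_sum_mul_le_of_monotone
      (z := fun j => ∑ i ∈ Finset.Ico (p (n j)) (p (n j + 1)), w (n j) i * (V i + σ * h i))
      ((monotone_average hw0 hw1 (hmono σ hσ)).comp hn.monotone)
      (fun j => (average_mem_Icc (hw0 _) (hw1 _) fun i _ => ⟨hpos σ hσ i, hle σ hσ i⟩).1)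
      (fun j => (average_mem_Icc (hw0 _) (hw1 _) fun i _ => ⟨hpos σ hσ i, hle σ hσ i⟩).2) k hA
  have k1 := key 1 abs_one
  have k2 := key (-1) (by simp)
  have e : ∀ j, ∑ i ∈ Finset.Ico (p (n j)) (p (n j + 1)), w (n j) i * h i =
      1 / 2 * (∑ i ∈ Finset.Ico (p (n j)) (p (n j + 1)), w (n j) i * (V i + 1 * h i)) -
      1 / 2 * ∑ i ∈ Finset.Ico (p (n j)) (p (n j + 1)), w (n j) i * (V i + -1 * h i) := fun j => by
    rw [← mul_sub, ← Finset.sum_sub_distrib, Finset.mul_sum]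
    exact Finset.sum_congr rfl fun i _ => by ring
  have e2 : ∑ j ∈ Finset.range k, a j * ∑ i ∈ Finset.Ico (p (n j)) (p (n j + 1)), w (n j) i * h i =
      1 / 2 * (∑ j ∈ Finset.range k, a j *
        ∑ i ∈ Finset.Ico (p (n j)) (p (n j + 1)), w (n j) i * (V i + 1 * h i)) -
      1 / 2 * ∑ j ∈ Finset.range k, a j *
        ∑ i ∈ Finset.Ico (p (n j)) (p (n j + 1)), w (n j) i * (V i + -1 * h i) := by
    rw [← mul_sub, ← Finset.sum_sub_distrib, Finset.mul_sum]
    exact Finset.sum_congr rfl fun j _ => by rw [e]; ring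
  rw [e2]
  rw [abs_le] at *
  constructor <;> linarith [k1.1, k1.2, k2.1, k2.2]

end Averages

/-! ### Functions of class `B_{1/4}` -/

section Quarter

variable {K : Type*} [MetricSpace K] [CompactSpace K]

theorem sum_abs_sub_le_of_tsum_le {h : ℕ → ℝ} {C : ℝ}
    (hs : Summable fun n => |h (n + 1) - h n|) (hC : ∑' n, |h (n + 1) - h n| ≤ C) (n : ℕ) :
    ∑ l ∈ Finset.range n, |h (l + 1) - h l| ≤ C :=
  (hs.sum_le_tsum _ fun _ _ => abs_nonneg _).trans hC

/-- The approximants of a function in `B_{1/4}(K)` come with sequences of continuous functions whose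
variations admit one common bound `C`. -/
theorem exists_approx_of_mem_BQuarter {F : K → ℝ} (hF : F ∈ BQuarter K) :
    ∃ C : ℝ, 0 ≤ C ∧ ∀ ε > 0, ∃ (h : ℕ → C(K, ℝ)) (H : K → ℝ), h 0 = 0 ∧ PointwiseLimit h H ∧
      (∀ t n, ∑ l ∈ Finset.range n, |h (l + 1) t - h l t| ≤ C) ∧ ∀ t, |H t - F t| ≤ ε := by
  obtain ⟨-, G, hG, ⟨B, hB⟩, hlim⟩ := hF
  refine ⟨max (B + 1) 0, le_max_right _ _, fun ε hε => ?_⟩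
  obtain ⟨n, hn⟩ := ((Metric.tendstoUniformly_iff.1 hlim) ε hε).exists
  have hne : {C : ℝ | 0 ≤ C ∧ DBSCWith (G n) C}.Nonempty := by
    obtain ⟨C, h, h0, hh, hC⟩ := hG n
    exact ⟨max C 0, le_max_right _ _, h, h0, hh, fun t =>
      ⟨(hC t).1, (hC t).2.trans (le_max_left _ _)⟩⟩
  have hlt : sInf {C : ℝ | 0 ≤ C ∧ DBSCWith (G n) C} < B + 1 :=
    lt_of_le_of_lt (hB ⟨n, rfl⟩) (lt_add_one B)
  obtain ⟨C, ⟨-, h, h0, hh, hC⟩, hCB⟩ := exists_lt_of_csInf_lt hne hlt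
  refine ⟨h, G n, h0, hh, fun t m => ?_, fun t => ?_⟩
  · exact (sum_abs_sub_le_of_tsum_le (h := fun n => h n t) (hC t).1 (hC t).2 m).trans
      (hCB.le.trans (le_max_left _ _))
  · have := hn t
    rw [dist_comm, Real.dist_eq] at this
    exact this.le

/-- Convex blocks of `f` that are close, in sup norm, to the blocks with the same weights of every
approximating sequence `h m`. Pointwise, `|f n - h m n|` has limit at most `ε m`, so its excess over
`ε m` tends to `0`, and the `j`-th block is chosen to make the excesses for all `m ≤ j` small at
once. -/
theorem exists_convex_blocks_near {f : ℕ → C(K, ℝ)} {F : K → ℝ} {M : ℝ} (hM : ∀ n, ‖f n‖ ≤ M)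
    (hlim : PointwiseLimit f F) {h : ℕ → ℕ → C(K, ℝ)} {H : ℕ → K → ℝ} {C : ℝ}
    (hC : ∀ m n, ‖h m n‖ ≤ C) (hH : ∀ m, PointwiseLimit (h m) (H m)) {ε : ℕ → ℝ}
    (hε0 : ∀ m, 0 ≤ ε m) (hε : ∀ m t, |H m t - F t| ≤ ε m) :
    ∃ (p : ℕ → ℕ) (w : ℕ → ℕ → ℝ), StrictMono p ∧ (∀ n i, 0 ≤ w n i) ∧
      (∀ n, ∑ i ∈ Finset.Ico (p n) (p (n + 1)), w n i = 1) ∧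
      ∀ j, ∀ m ≤ j, ∀ t, |∑ i ∈ Finset.Ico (p j) (p (j + 1)), w j i * (f i t - h m i t)| ≤
        ε m + 1 / ((j : ℝ) + 1) := by
  let d : ℕ → ℕ → C(K, ℝ) := fun m n => ⟨fun t => max (|f n t - h m n t| - ε m) 0, by fun_prop⟩
  have hd : ∀ m n t, d m n t = max (|f n t - h m n t| - ε m) 0 := fun _ _ _ => rfl
  have hM0 : 0 ≤ M := (norm_nonneg _).trans (hM 0)
  have hC0 : 0 ≤ C := (norm_nonneg _).trans (hC 0 0)
  have hdnorm : ∀ m n, ‖d m n‖ ≤ M + C := fun m n => by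
    rw [ContinuousMap.norm_le _ (by positivity)]
    intro t
    rw [hd, Real.norm_of_nonneg (le_max_right _ _)]
    refine max_le ?_ (by positivity)
    have h1 := abs_sub (f n t) (h m n t)
    have h2 := ((f n).norm_coe_le_norm t).trans (hM n)
    have h3 := ((h m n).norm_coe_le_norm t).trans (hC m n)
    rw [Real.norm_eq_abs] at h2 h3
    linarith [hε0 m]
  have hdlim : ∀ m t, Tendsto (fun n => d m n t) atTop (𝓝 0) := fun m t => by
    have h1 : Tendsto (fun n => d m n t) atTop (𝓝 (max (|F t - H m t| - ε m) 0)) :=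
      ((((hlim t).sub (hH m t)).abs).sub_const _).max tendsto_const_nhds
    have h2 := hε m t
    rw [abs_sub_comm] at h2
    rwa [max_eq_right (by linarith)] at h1
  have key : ∀ j N : ℕ, ∃ N' > N, ∃ w : ℕ → ℝ, (∀ i, 0 ≤ w i) ∧ ∑ i ∈ Finset.Ico N N', w i = 1 ∧
      ∀ t, ∑ i ∈ Finset.Ico N N', w i * (∑ m ∈ Finset.range (j + 1), d m i) t <
        1 / ((j : ℝ) + 1) := fun j N => by
    refine exists_convex_combination_lt (M := (j + 1 : ℕ) * (M + C)) (fun n => ?_) (fun t => ?_)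
      (by positivity) N
    · refine (norm_sum_le _ _).trans ((Finset.sum_le_card_nsmul _ _ _ fun m _ => hdnorm m n).trans ?_)
      rw [Finset.card_range, nsmul_eq_mul]
    · have := tendsto_finsetSum (Finset.range (j + 1)) fun m _ => hdlim m t
      simpa [ContinuousMap.coe_sum] using this
  choose q hq w hw0 hw1 hw using key
  let p : ℕ → ℕ := fun j => Nat.rec 0 (fun j r => q j r) j
  have hp : ∀ j, p (j + 1) = q j (p j) := fun j => rfl
  refine ⟨p, fun j => w j (p j), strictMono_nat_of_lt_succ fun j => hq j (p j),
    fun j => hw0 j (p j), fun j => hw1 j (p j), fun j m hm t => ?_⟩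
  rw [hp]
  have h1 : ∀ i ∈ Finset.Ico (p j) (q j (p j)), |w j (p j) i * (f i t - h m i t)| ≤
      w j (p j) i * ε m + w j (p j) i * (∑ m ∈ Finset.range (j + 1), d m i) t := by
    intro i _
    rw [abs_mul, abs_of_nonneg (hw0 _ _ _), ← mul_add]
    refine mul_le_mul_of_nonneg_left ?_ (hw0 _ _ _)
    have h2 : d m i t ≤ (∑ m ∈ Finset.range (j + 1), d m i) t := by
      rw [ContinuousMap.coe_sum, Finset.sum_apply]
      exact Finset.single_le_sum (f := fun m => d m i t)
        (fun m _ => le_max_right _ _)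
        (Finset.mem_range.2 (by omega))
    have h3 : |f i t - h m i t| - ε m ≤ d m i t := le_max_left _ _
    linarith
  refine (Finset.abs_sum_le_sum_abs _ _).trans ((Finset.sum_le_sum h1).trans ?_)
  rw [Finset.sum_add_distrib, ← Finset.sum_mul, hw1, one_mul]
  exact add_le_add_right (hw j (p j) t).le _

/-- A linear combination of a subsequence is a linear combination of the sequence, with zero
coefficients inserted; the terms with `l ≤ i` are those with index at least `L`. -/
theorem sum_Ico_insert_zeros {X : Type*} [AddCommGroup X] [Module ℝ X] {n : ℕ → ℕ}
    (hn : StrictMono n) (a : ℕ → ℝ) {L l k : ℕ} (hL : ∀ i, L ≤ n i ↔ l ≤ i) (y : ℕ → X) :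
    ∑ j ∈ Finset.Ico L (n k), (∑ i ∈ Finset.range k, if n i = j then a i else 0) • y j =
      ∑ i ∈ Finset.Ico l k, a i • y (n i) := by
  simp only [Finset.sum_smul, ite_smul, zero_smul]
  rw [Finset.sum_comm]
  have hsub : Finset.Ico l k ⊆ Finset.range k := fun i hi => by
    simp only [Finset.mem_Ico] at hi; simp only [Finset.mem_range]; omega
  rw [← Finset.sum_subset hsub]
  · refine Finset.sum_congr rfl fun i hi => ?_
    rw [Finset.mem_Ico] at hi
    rw [Finset.sum_ite_eq, if_pos (Finset.mem_Ico.2 ⟨(hL i).2 hi.1, hn hi.2⟩)]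
  · intro i hi hi'
    rw [Finset.mem_range] at hi
    rw [Finset.sum_ite_eq, if_neg]
    intro h
    rw [Finset.mem_Ico] at h hi'
    exact hi' ⟨(hL i).1 h.1, hi⟩

theorem exists_convexBlock_hasSpreadingModel_summingBasis {f : ℕ → C(K, ℝ)} {F : K → ℝ} {M : ℝ}
    (hM : ∀ n, ‖f n‖ ≤ M) (hlim : PointwiseLimit f F) (hF : F ∈ BQuarter K)
    (hFc : ¬ Continuous F) :
    ∃ g : ℕ → C(K, ℝ), IsConvexBlockSubseq g f ∧ HasSpreadingModelEquivTo g summingBasis := by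
  have hM0 : 0 ≤ M := (norm_nonneg _).trans (hM 0)
  obtain ⟨C, hC0, happrox⟩ := exists_approx_of_mem_BQuarter hF
  choose h H h0 hH hvar hHF using fun m : ℕ => happrox (1 / ((m : ℝ) + 1)) (by positivity)
  have hhC : ∀ m n, ‖h m n‖ ≤ C := fun m n => by
    rw [ContinuousMap.norm_le _ hC0]
    intro t
    have h1 := hvar m t n
    have h2 : h m n t = ∑ l ∈ Finset.range n, (h m (l + 1) t - h m l t) := by
      rw [Finset.sum_range_sub (fun l => h m l t), h0]; simp
    rw [h2, Real.norm_eq_abs]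
    exact (Finset.abs_sum_le_sum_abs _ _).trans h1
  obtain ⟨p, w, hp, hw0, hw1, hnear⟩ := exists_convex_blocks_near hM hlim hhC hH
    (fun m => by positivity) hHF
  let g : ℕ → C(K, ℝ) := fun j => ∑ i ∈ Finset.Ico (p j) (p (j + 1)), w j i • f i
  have hg : ∀ j t, g j t = ∑ i ∈ Finset.Ico (p j) (p (j + 1)), w j i * f i t := fun j t => by
    simp [g, ContinuousMap.coe_sum]
  have hgM : ∀ j, ‖g j‖ ≤ M := fun j => by
    rw [ContinuousMap.norm_le _ hM0]
    intro t
    rw [hg, Real.norm_eq_abs, abs_le]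
    exact average_mem_Icc (hw0 j) (hw1 j) fun i _ =>
      abs_le.1 (((f i).norm_coe_le_norm t).trans (hM i))
  have hglim : PointwiseLimit g F := fun t => by
    rw [Metric.tendsto_atTop]
    intro ε hε
    obtain ⟨N, hN⟩ := Metric.tendsto_atTop.1 (hlim t) (ε / 2) (by positivity)
    refine ⟨N, fun j hj => ?_⟩
    have h1 := average_mem_Icc (hw0 j) (hw1 j) (z := fun i => f i t) (b := F t - ε / 2)
      (c := F t + ε / 2) fun i hi => by
        have h2 := (hN i (hj.trans ((hp.id_le j).trans (Finset.mem_Ico.1 hi).1))).le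
        rw [Real.dist_eq, abs_le] at h2
        constructor <;> linarith [h2.1, h2.2]
    rw [Real.dist_eq, hg, abs_lt]
    constructor <;> linarith [h1.1, h1.2]
  obtain ⟨ψ, hψ, D, hD0, hD⟩ := exists_subseq_norm_partial_sum_le hgM hglim hFc
  -- for `k` terms, the approximant `h k` is good enough: the errors, about `2 / (k + 1)` each, add up
  -- to at most a constant
  have hupper : ∀ k, ∀ n : ℕ → ℕ, StrictMono n → (∀ i, k ≤ n i) → ∀ a : ℕ → ℝ,
      ‖∑ i ∈ Finset.range k, a i • g (n i)‖ ≤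
        (4 * C + 4) * ‖∑ i ∈ Finset.range k, a i • summingBasis i‖ := by
    intro k n hn hkn a
    set A := ‖∑ i ∈ Finset.range k, a i • summingBasis i‖ with hAdef
    have hA : ∀ l ≤ k, |∑ i ∈ Finset.range l, a i| ≤ A := fun l hl =>
      abs_sum_le_norm_sum_summingBasis a hl
    have ha : ∀ i ∈ Finset.range k, |a i| ≤ 2 * A := fun i hi => by
      rw [Finset.mem_range] at hi
      have h1 := hA i hi.le
      have h2 := hA (i + 1) hi
      rw [Finset.sum_range_succ] at h2
      rw [abs_le] at h1 h2 ⊢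
      constructor <;> linarith [h1.1, h1.2, h2.1, h2.2]
    rw [ContinuousMap.norm_le _ (by positivity)]
    intro t
    have hsplit : (∑ i ∈ Finset.range k, a i • g (n i)) t =
        ∑ j ∈ Finset.range k, a j * ∑ i ∈ Finset.Ico (p (n j)) (p (n j + 1)),
          w (n j) i * h k i t +
        ∑ j ∈ Finset.range k, a j * ∑ i ∈ Finset.Ico (p (n j)) (p (n j + 1)),
          w (n j) i * (f i t - h k i t) := by
      rw [← Finset.sum_add_distrib, ContinuousMap.coe_sum, Finset.sum_apply]
      refine Finset.sum_congr rfl fun j _ => ?_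
      rw [ContinuousMap.coe_smul, Pi.smul_apply, hg, smul_eq_mul, ← mul_add,
        ← Finset.sum_add_distrib]
      congr 1
      exact Finset.sum_congr rfl fun i _ => by ring
    have h1 := abs_sum_mul_average_le hw0 hw1 (h := fun i => h k i t) (by simp [h0]) (hvar k t) hn k hA
    have h2 : |∑ j ∈ Finset.range k, a j * ∑ i ∈ Finset.Ico (p (n j)) (p (n j + 1)),
          w (n j) i * (f i t - h k i t)| ≤ 4 * A := by
      have h3 : ∀ j ∈ Finset.range k, |a j * ∑ i ∈ Finset.Ico (p (n j)) (p (n j + 1)),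
          w (n j) i * (f i t - h k i t)| ≤ 2 * A * (2 / ((k : ℝ) + 1)) := by
        intro j hj
        rw [abs_mul]
        refine mul_le_mul (ha j hj) ((hnear (n j) k (hkn j) t).trans ?_) (abs_nonneg _)
          (by positivity)
        have h4 : 1 / ((n j : ℝ) + 1) ≤ 1 / ((k : ℝ) + 1) := by
          gcongr; exact hkn j
        have h5 : 2 / ((k : ℝ) + 1) = 1 / ((k : ℝ) + 1) + 1 / ((k : ℝ) + 1) := by ring
        linarith
      refine (Finset.abs_sum_le_sum_abs _ _).trans ((Finset.sum_le_card_nsmul _ _ _ h3).trans ?_)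
      rw [Finset.card_range, nsmul_eq_mul]
      have h6 : (k : ℝ) * (2 * A * (2 / ((k : ℝ) + 1))) = 4 * A * (k / ((k : ℝ) + 1)) := by ring
      rw [h6]
      refine mul_le_of_le_one_right (by positivity) ?_
      rw [div_le_one (by positivity)]
      linarith
    rw [hsplit, Real.norm_eq_abs]
    refine (abs_add_le _ _).trans ((add_le_add h1 h2).trans (le_of_eq (by ring)))
  have hlower : ∀ k, ∀ n : ℕ → ℕ, StrictMono n → ∀ a : ℕ → ℝ,
      ‖∑ i ∈ Finset.range k, a i • summingBasis i‖ ≤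
        2 * D * ‖∑ i ∈ Finset.range k, a i • g (ψ (n i))‖ := by
    intro k n hn a
    refine norm_sum_summingBasis_le fun l hl => ?_
    let b : ℕ → ℝ := fun j => ∑ i ∈ Finset.range k, if n i = j then a i else 0
    have hx : ∑ j ∈ Finset.range (n k), b j • g (ψ j) =
        ∑ i ∈ Finset.range k, a i • g (ψ (n i)) := by
      simpa using sum_Ico_insert_zeros hn a (L := 0) (l := 0) (k := k) (by simp) fun j => g (ψ j)
    have htail : ∀ l ≤ k, |∑ i ∈ Finset.Ico l k, a i| ≤
        D * ‖∑ i ∈ Finset.range k, a i • g (ψ (n i))‖ := fun l hl => by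
      have h1 := (hD (n k) b (n l) (hn.monotone hl)).2
      rw [hx] at h1
      have h2 := sum_Ico_insert_zeros hn a (L := n l) (l := l) (k := k)
        (fun i => hn.le_iff_le) fun _ => (1 : ℝ)
      simp only [smul_eq_mul, mul_one] at h2
      rwa [← h2]
    have h1 := htail 0 k.zero_le
    have h2 := htail l hl
    rw [← Finset.range_eq_Ico, ← Finset.sum_range_add_sum_Ico _ hl] at h1
    rw [abs_le] at *
    constructor <;> linarith [h1.1, h1.2, h2.1, h2.2]
  obtain ⟨θ, hθ, hmodel⟩ := exists_subseq_hasSpreadingModelEquivTo (f := fun n => g (ψ n))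
    (fun n => hgM _) (fun t => (hglim t).comp hψ.tendsto_atTop) hFc summingBasis_ne_zero
    (fun m n hmn a => norm_sum_summingBasis_le fun l hl =>
      abs_sum_le_norm_sum_summingBasis a (hl.trans hmn))
    (D := max (4 * C + 4) (2 * D)) (by positivity) (fun k => ⟨k, fun n hn hkn a =>
      ⟨(hupper k (ψ ∘ n) (hψ.comp hn) (fun i => (hkn i).trans (hψ.id_le _)) a).trans
        (mul_le_mul_of_nonneg_right (le_max_left _ _) (norm_nonneg _)),
      (hlower k n hn a).trans
        (mul_le_mul_of_nonneg_right (le_max_right _ _) (norm_nonneg _))⟩⟩)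
  exact ⟨_, (isConvexBlockSubseq_of_weights hp hw0 hw1 fun n => rfl).comp_strictMono
    (hψ.comp hθ), hmodel⟩

end Quarter

/-! ### The class `DBSC(K)` -/

section DBSC

variable {K : Type*} [TopologicalSpace K] [CompactSpace K]

theorem mem_DBSC_of_sum_le {F : K → ℝ} {f : ℕ → C(K, ℝ)} {C : ℝ} (h0 : f 0 = 0)
    (hf : PointwiseLimit f F)
    (hC : ∀ t n, ∑ l ∈ Finset.range n, |f (l + 1) t - f l t| ≤ C) : F ∈ DBSC K :=
  ⟨C, f, h0, hf, fun t => ⟨summable_of_sum_range_le (fun _ => abs_nonneg _) (hC t),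
    Real.tsum_le_of_sum_range_le (fun _ => abs_nonneg _) (hC t)⟩⟩

theorem add_mem_DBSC {F G : K → ℝ} (hF : F ∈ DBSC K) (hG : G ∈ DBSC K) : F + G ∈ DBSC K := by
  obtain ⟨C, f, f0, hf, hC⟩ := hF
  obtain ⟨D, g, g0, hg, hD⟩ := hG
  refine mem_DBSC_of_sum_le (f := f + g) (C := C + D) (by simp [f0, g0])
    (fun t => (hf t).add (hg t)) fun t n => ?_
  refine le_trans ?_ (add_le_add
    (sum_abs_sub_le_of_tsum_le (h := fun n => f n t) (hC t).1 (hC t).2 n)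
    (sum_abs_sub_le_of_tsum_le (h := fun n => g n t) (hD t).1 (hD t).2 n))
  rw [← Finset.sum_add_distrib]
  refine Finset.sum_le_sum fun l _ => ?_
  have : (f + g) (l + 1) t - (f + g) l t =
      (f (l + 1) t - f l t) + (g (l + 1) t - g l t) := by
    simp only [Pi.add_apply, ContinuousMap.add_apply]; ring
  rw [this]
  exact abs_add_le _ _

theorem smul_mem_DBSC {F : K → ℝ} (c : ℝ) (hF : F ∈ DBSC K) : c • F ∈ DBSC K := by
  obtain ⟨C, f, f0, hf, hC⟩ := hF
  refine mem_DBSC_of_sum_le (f := fun n => c • f n) (C := |c| * C) (by simp [f0])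
    (fun t => (hf t).const_mul c) fun t n => ?_
  have h1 := sum_abs_sub_le_of_tsum_le (h := fun n => f n t) (hC t).1 (hC t).2 n
  refine le_trans (le_of_eq ?_) (mul_le_mul_of_nonneg_left h1 (abs_nonneg c))
  rw [Finset.mul_sum]
  refine Finset.sum_congr rfl fun l _ => ?_
  rw [← abs_mul, mul_sub]
  rfl

theorem zero_mem_DBSC : (0 : K → ℝ) ∈ DBSC K :=
  mem_DBSC_of_sum_le (f := fun _ => 0) (C := 0) rfl (fun _ => tendsto_const_nhds) fun t n => by simp

theorem sum_mem_DBSC {F : ℕ → K → ℝ} (hF : ∀ i, F i ∈ DBSC K) (n : ℕ) :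
    ∑ i ∈ Finset.range n, F i ∈ DBSC K := by
  induction n with
  | zero => exact zero_mem_DBSC
  | succ n ih => rw [Finset.sum_range_succ]; exact add_mem_DBSC ih (hF n)

end DBSC

/-! ### Oscillation derivatives and uniform approximation -/

section Derivative

variable {K : Type*} [TopologicalSpace K]

/-- The iterated derivative measuring how often `F` oscillates between the values `r` and `s`: each
step keeps the points that are limits both of points with `s ≤ F` and of points with `F ≤ r`. -/
def oscDeriv (F : K → ℝ) (r s : ℝ) : ℕ → Set K
  | 0 => Set.univ
  | n + 1 => closure (oscDeriv F r s n ∩ {t | s ≤ F t}) ∩ closure (oscDeriv F r s n ∩ {t | F t ≤ r})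

theorem isClosed_oscDeriv (F : K → ℝ) (r s : ℝ) : ∀ n, IsClosed (oscDeriv F r s n)
  | 0 => isClosed_univ
  | _ + 1 => isClosed_closure.inter isClosed_closure

theorem closure_oscDeriv_inter_subset (F : K → ℝ) (r s : ℝ) (n : ℕ) (A : Set K) :
    closure (oscDeriv F r s n ∩ A) ⊆ oscDeriv F r s n :=
  closure_minimal Set.inter_subset_left (isClosed_oscDeriv F r s n)

theorem oscDeriv_antitone (F : K → ℝ) (r s : ℝ) : Antitone (oscDeriv F r s) :=
  antitone_nat_of_succ_le fun n => Set.inter_subset_left.trans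
    (closure_oscDeriv_inter_subset F r s n _)

end Derivative

section Separation

variable {K : Type*} [MetricSpace K] [CompactSpace K]

theorem indicator_mem_DBSC {A : Set K} (hA : IsClosed A) :
    A.indicator (fun _ => (1 : ℝ)) ∈ DBSC K := by
  rcases A.eq_empty_or_nonempty with rfl | hne
  · rw [Set.indicator_empty]; exact zero_mem_DBSC
  let g : ℕ → C(K, ℝ) := fun n => ⟨fun t => max (1 - n * Metric.infDist t A) 0, by fun_prop⟩
  have hg : ∀ n t, g n t = max (1 - n * Metric.infDist t A) 0 := fun _ _ => rfl
  have hanti : ∀ n t, g (n + 1) t ≤ g n t := fun n t => by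
    rw [hg, hg]
    have : (0 : ℝ) ≤ Metric.infDist t A := Metric.infDist_nonneg
    refine max_le_max ?_ le_rfl
    push_cast
    nlinarith
  have hg0 : ∀ n t, 0 ≤ g n t := fun n t => le_max_right _ _
  have hg1 : ∀ n t, g n t ≤ 1 := fun n t => by
    have : (0 : ℝ) ≤ Metric.infDist t A := Metric.infDist_nonneg
    exact max_le (sub_le_self _ (by positivity)) zero_le_one
  refine mem_DBSC_of_sum_le (f := fun n => if n = 0 then 0 else g n) (C := 2) rfl (fun t => ?_)
    fun t n => ?_
  · have h1 : (fun n => (if n = 0 then 0 else g n : C(K, ℝ)) t) =ᶠ[atTop] fun n => g n t :=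
      (eventually_ne_atTop 0).mono fun n hn => by simp [hn]
    refine Tendsto.congr' h1.symm ?_
    by_cases ht : t ∈ A
    · simp [hg, Metric.infDist_zero_of_mem ht, ht]
    · rw [Set.indicator_of_notMem ht]
      have hpos : 0 < Metric.infDist t A := (hA.notMem_iff_infDist_pos hne).1 ht
      obtain ⟨N, hN⟩ := exists_nat_gt (1 / Metric.infDist t A)
      refine tendsto_const_nhds.congr' ((eventually_ge_atTop N).mono fun n hn => ?_)
      change 0 = g n t
      rw [hg, max_eq_right]
      have h2 : 1 / Metric.infDist t A < n := hN.trans_le (Nat.cast_le.2 hn)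
      rw [div_lt_iff₀ hpos] at h2
      linarith
  · rcases n with _ | n
    · simp
    rw [Finset.sum_range_succ']
    have h2 : ∀ l ∈ Finset.range n,
        |(if l + 1 + 1 = 0 then 0 else g (l + 1 + 1) : C(K, ℝ)) t -
          (if l + 1 = 0 then 0 else g (l + 1) : C(K, ℝ)) t| = g (l + 1) t - g (l + 1 + 1) t :=
      fun l _ => by
        rw [if_neg (by omega), if_neg (by omega), abs_sub_comm, abs_of_nonneg]
        exact sub_nonneg.2 (hanti _ _)
    rw [Finset.sum_congr rfl h2, Finset.sum_range_sub' fun l => g (l + 1) t]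
    have h3 := hg0 (n + 1) t
    have h4 := hg1 1 t
    have h5 : |g 1 t| ≤ 1 := by rw [abs_of_nonneg (hg0 1 t)]; exact h4
    simp only [zero_add, one_ne_zero, if_false, if_true, ContinuousMap.zero_apply, sub_zero]
    linarith

/-- If the derivatives vanish after finitely many steps, the sets `{s ≤ F}` and `{F ≤ r}` are
separated by a finite disjoint union of differences of closed sets. -/
theorem exists_mem_DBSC_separating {F : K → ℝ} {r s : ℝ} {n : ℕ} (hn : oscDeriv F r s n = ∅) :
    ∃ χ ∈ DBSC K, ∀ t, (0 ≤ χ t ∧ χ t ≤ 1) ∧ (s ≤ F t → χ t = 1) ∧ (F t ≤ r → χ t = 0) := by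
  set P := oscDeriv F r s with hP
  let Q : ℕ → Set K := fun j => closure (P j ∩ {t | F t ≤ r})
  let χ : ℕ → K → ℝ := fun j =>
    (P j).indicator (fun _ => (1 : ℝ)) + (-1 : ℝ) • (Q j).indicator (fun _ => (1 : ℝ))
  have hχ : ∀ j, χ j ∈ DBSC K := fun j => add_mem_DBSC
    (indicator_mem_DBSC (isClosed_oscDeriv F r s j))
    (smul_mem_DBSC _ (indicator_mem_DBSC isClosed_closure))
  have hQP : ∀ j, Q j ⊆ P j := fun j => closure_oscDeriv_inter_subset F r s j _
  have hPQ : ∀ j, P (j + 1) ⊆ Q j := fun j => Set.inter_subset_right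
  refine ⟨∑ j ∈ Finset.range n, χ j, sum_mem_DBSC hχ n, fun t => ?_⟩
  classical
  -- the last derivative containing `t` gives the only nonzero term of the sum
  have hex : ∃ j, t ∉ P j := ⟨n, by rw [hn]; exact Set.notMem_empty t⟩
  obtain ⟨j, hj⟩ : ∃ j, Nat.find hex = j + 1 := by
    refine ⟨Nat.find hex - 1, ?_⟩
    have : Nat.find hex ≠ 0 := fun h => by
      have := Nat.find_spec hex
      rw [h] at this
      exact this (Set.mem_univ t)
    omega
  have hjn : j + 1 ≤ n := hj ▸ Nat.find_min' hex (by rw [hn]; exact Set.notMem_empty t)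
  have htj1 : t ∉ P (j + 1) := hj ▸ Nat.find_spec hex
  have htj : t ∈ P j := by
    by_contra h
    have := Nat.find_min' hex h
    omega
  have hsum : (∑ i ∈ Finset.range n, χ i) t = if t ∈ Q j then 0 else 1 := by
    rw [Finset.sum_apply, Finset.sum_eq_single_of_mem j (by simp; omega)]
    · simp only [χ, Pi.add_apply, Pi.smul_apply, Set.indicator_of_mem htj, smul_eq_mul]
      by_cases h : t ∈ Q j <;> simp [h]
    · intro i _ hij
      simp only [χ, Pi.add_apply, Pi.smul_apply, smul_eq_mul]
      rcases lt_or_gt_of_ne hij with h | h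
      · have h1 : t ∈ P (i + 1) := oscDeriv_antitone F r s h htj
        rw [Set.indicator_of_mem (hQP i (hPQ i h1)), Set.indicator_of_mem (hPQ i h1)]
        norm_num
      · have h1 : t ∉ P i := fun h1 => htj1 (oscDeriv_antitone F r s h h1)
        rw [Set.indicator_of_notMem h1, Set.indicator_of_notMem fun h2 => h1 (hQP i h2)]
        norm_num
  rw [hsum]
  refine ⟨by split_ifs <;> norm_num, fun h => if_neg fun h1 => ?_, fun h => if_pos ?_⟩
  · exact htj1 ⟨subset_closure ⟨htj, h⟩, h1⟩
  · exact subset_closure ⟨htj, h⟩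

/-- A sum of `N` functions of `x`, the `i`-th one rising from `0` to `1` on `[i, i + 1]`, is within
`1` of `x` as long as `x ≤ N`, and equals `N` beyond. -/
theorem abs_sum_steps_sub_le {c : ℕ → ℝ} {x : ℝ} (hx : 0 ≤ x) (hc : ∀ i, 0 ≤ c i ∧ c i ≤ 1)
    (h1 : ∀ i : ℕ, (i : ℝ) + 1 ≤ x → c i = 1) (h0 : ∀ i : ℕ, x ≤ i → c i = 0) (N : ℕ) :
    ((N : ℝ) ≤ x → ∑ i ∈ Finset.range N, c i = N) ∧
      (x ≤ N → |∑ i ∈ Finset.range N, c i - x| ≤ 1) := by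
  induction N with
  | zero => simpa using fun h : x ≤ 0 => by rw [le_antisymm h hx]; simp
  | succ N ih =>
    rw [Finset.sum_range_succ]
    push_cast
    refine ⟨fun h => by rw [ih.1 (by linarith), h1 N h], fun h => ?_⟩
    rcases le_total x N with hN | hN
    · rw [h0 N hN, add_zero]; exact ih.2 hN
    · rw [ih.1 hN, abs_le]
      constructor <;> linarith [(hc N).1, (hc N).2]

/-- A bounded function is uniformly approximated by the step function `-M + ε ∑ χ i`, where `χ i`
separates `{F ≤ -M + i ε}` from `{-M + (i + 1) ε ≤ F}`. -/
theorem mem_BHalf_of_oscDeriv_eq_empty {F : K → ℝ} (hF : F ∈ B1 K) {M : ℝ} (hM : ∀ t, |F t| ≤ M)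
    (h : ∀ r s, r < s → ∃ n, oscDeriv F r s n = ∅) : F ∈ BHalf K := by
  have happrox : ∀ ε > 0, ∃ G ∈ DBSC K, ∀ t, |G t - F t| ≤ ε := by
    intro ε hε
    choose n hn using h
    choose χ hχ hχF using fun i : ℕ => exists_mem_DBSC_separating
      (hn (-M + ε * i) (-M + ε * (i + 1)) (by nlinarith))
    obtain ⟨N, hN⟩ := exists_nat_gt (2 * M / ε)
    rw [div_lt_iff₀ hε] at hN
    refine ⟨(-M) • Set.univ.indicator (fun _ => (1 : ℝ)) + ε • ∑ i ∈ Finset.range N, χ i,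
      add_mem_DBSC (smul_mem_DBSC _ (indicator_mem_DBSC isClosed_univ))
        (smul_mem_DBSC _ (sum_mem_DBSC hχ N)), fun t => ?_⟩
    have hMt := abs_le.1 (hM t)
    have key := (abs_sum_steps_sub_le (c := fun i => χ i t) (x := (F t + M) / ε)
      (div_nonneg (by linarith [hMt.1]) hε.le) (fun i => (hχF i t).1)
      (fun i hi => (hχF i t).2.1 (by rw [le_div_iff₀ hε] at hi; linarith))
      (fun i hi => (hχF i t).2.2 (by rw [div_le_iff₀ hε] at hi; linarith)) N).2
      (by rw [div_le_iff₀ hε]; linarith [hMt.2])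
    have e : ((-M) • Set.univ.indicator (fun _ => (1 : ℝ)) + ε • ∑ i ∈ Finset.range N, χ i :
        K → ℝ) t - F t =
        ε * (∑ i ∈ Finset.range N, χ i t - (F t + M) / ε) := by
      simp only [Pi.add_apply, Pi.smul_apply, Set.indicator_univ, smul_eq_mul, Finset.sum_apply]
      field_simp
      ring
    rw [e, abs_mul, abs_of_pos hε]
    exact mul_le_of_le_one_right hε.le key
  choose G hG hGF using fun n : ℕ => happrox (1 / ((n : ℝ) + 1)) (by positivity)
  refine ⟨hF, G, hG, Metric.tendstoUniformly_iff.2 fun ε hε => ?_⟩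
  obtain ⟨N, hN⟩ := exists_nat_one_div_lt hε
  filter_upwards [eventually_ge_atTop N] with n hn t
  rw [dist_comm, Real.dist_eq]
  refine (hGF n t).trans_lt (lt_of_le_of_lt ?_ hN)
  gcongr

end Separation

/-! ### Functions outside `B_{1/2}` -/

section EllOne

theorem norm_sum_ellOneBasis (m : ℕ) (a : ℕ → ℝ) :
    ‖∑ i ∈ Finset.range m, a i • ellOneBasis i‖ = ∑ i ∈ Finset.range m, |a i| := by
  have h := lp.norm_sum_single (E := fun _ : ℕ => ℝ) (p := 1) (by simp) a (Finset.range m)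
  have e : ∑ i ∈ Finset.range m, a i • ellOneBasis i =
      ∑ i ∈ Finset.range m, lp.single (E := fun _ : ℕ => ℝ) 1 i (a i) := by
    refine Finset.sum_congr rfl fun i _ => ?_
    rw [ellOneBasis, ← lp.single_smul, smul_eq_mul, mul_one]
  rw [e]
  simpa using h

theorem ellOneBasis_ne_zero (n : ℕ) : ellOneBasis n ≠ 0 := fun h => by
  have h1 := norm_sum_ellOneBasis (n + 1) fun i => if i = n then 1 else 0
  simp [ite_smul, h, apply_ite abs] at h1

/-- If all iterated derivatives are nonempty, a subsequence of `f` is such that `k` terms beyond the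
`k`-th one are independent: any prescription of the terms that are large and of those that are small
is met at some point. -/
theorem exists_subseq_independent {K : Type*} [TopologicalSpace K] {f : ℕ → C(K, ℝ)}
    {F : K → ℝ} (hlim : PointwiseLimit f F)
    {r s r' s' : ℝ} (hr : r < r') (hs : s' < s) (hne : ∀ n, (oscDeriv F r s n).Nonempty) :
    ∃ φ : ℕ → ℕ, StrictMono φ ∧ ∀ j (σ : Finset ℕ), (∀ i ∈ σ, j ≤ i) → σ.card ≤ j →
      ∀ S ⊆ σ.image φ, ∃ t, ∀ n ∈ σ.image φ, (n ∈ S → s' < f n t) ∧ (n ∉ S → f n t < r') := by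
  -- the points sought are kept in a derivative high enough for the steps that remain
  let G : ℕ → Finset ℕ → Prop := fun j σ => σ.card ≤ j → ∀ S ∈ σ.powerset,
    ∃ t ∈ oscDeriv F r s (j - σ.card), ∀ n ∈ σ, (n ∈ S → s' < f n t) ∧ (n ∉ S → f n t < r')
  obtain ⟨φ, hφ, hG⟩ := exists_strictMono_of_eventually_insert le_rfl G
    (fun j _ S _ => by
      obtain ⟨t, ht⟩ := hne j
      exact ⟨t, by simpa using ht, by simp⟩)
    (fun j σ hσ => by
      have hns : ∀ᶠ n in atTop, ∀ i ∈ σ, i < n :=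
        (Filter.eventually_all_finset σ).2 fun i _ => eventually_gt_atTop i
      by_cases hcard : σ.card < j
      swap
      · filter_upwards [hns] with n hn hle
        have hn0 : n ∉ σ := fun hmem => lt_irrefl _ (hn n hmem)
        rw [Finset.card_insert_of_notMem hn0] at hle
        omega
      obtain ⟨d, hd⟩ : ∃ d, j - σ.card = d + 1 := ⟨j - σ.card - 1, by omega⟩
      -- every cell contains nearby points of the previous derivative at which `F` is large, and
      -- such points at which `F` is small
      have hcell : ∀ S ∈ σ.powerset, ∀ᶠ n in atTop,
          (∃ t ∈ oscDeriv F r s d, (∀ i ∈ σ, (i ∈ S → s' < f i t) ∧ (i ∉ S → f i t < r')) ∧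
            s' < f n t) ∧
          ∃ t ∈ oscDeriv F r s d, (∀ i ∈ σ, (i ∈ S → s' < f i t) ∧ (i ∉ S → f i t < r')) ∧
            f n t < r' := by
        intro S hS
        obtain ⟨t, ht, htS⟩ := hσ hcard.le S hS
        rw [hd] at ht
        have hopen : ∀ᶠ y in 𝓝 t, ∀ i ∈ σ, (i ∈ S → s' < f i y) ∧ (i ∉ S → f i y < r') := by
          refine (Filter.eventually_all_finset σ).2 fun i hi => ?_
          by_cases hiS : i ∈ S
          · filter_upwards [((f i).continuous.tendsto t).eventually_const_lt ((htS i hi).1 hiS)]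
              with y hy
            exact ⟨fun _ => hy, fun h => absurd hiS h⟩
          · filter_upwards [((f i).continuous.tendsto t).eventually_lt_const ((htS i hi).2 hiS)]
              with y hy
            exact ⟨fun h => absurd h hiS, fun _ => hy⟩
        obtain ⟨y, ⟨hyP, hys⟩, hyS⟩ :=
          ((mem_closure_iff_frequently.1 ht.1).and_eventually hopen).exists
        obtain ⟨z, ⟨hzP, hzr⟩, hzS⟩ :=
          ((mem_closure_iff_frequently.1 ht.2).and_eventually hopen).exists
        filter_upwards [(hlim y).eventually_const_lt (lt_of_lt_of_le hs hys),
          (hlim z).eventually_lt_const (lt_of_le_of_lt hzr hr)] with n hny hnz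
        exact ⟨⟨y, hyP, hyS, hny⟩, z, hzP, hzS, hnz⟩
      filter_upwards [hns, (Filter.eventually_all_finset _).2 hcell] with n hn hncell hle S hS
      have hn0 : n ∉ σ := fun hmem => lt_irrefl _ (hn n hmem)
      rw [Finset.card_insert_of_notMem hn0] at hle ⊢
      have hd' : j - (σ.card + 1) = d := by omega
      rw [hd']
      have hmem : ∀ i ∈ σ, (i ∈ S.erase n ↔ i ∈ S) := fun i hi => by
        rw [Finset.mem_erase]
        exact ⟨fun h => h.2, fun h => ⟨fun h' => hn0 (h' ▸ hi), h⟩⟩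
      obtain ⟨⟨y, hyP, hyS, hny⟩, z, hzP, hzS, hnz⟩ := hncell (S.erase n)
        (Finset.mem_powerset.2 (Finset.subset_insert_iff.1 (Finset.mem_powerset.1 hS)))
      by_cases hnS : n ∈ S
      · refine ⟨y, hyP, fun i hi => ?_⟩
        rcases Finset.mem_insert.1 hi with rfl | hi
        · exact ⟨fun _ => hny, fun h => absurd hnS h⟩
        · rw [← hmem i hi]; exact hyS i hi
      · refine ⟨z, hzP, fun i hi => ?_⟩
        rcases Finset.mem_insert.1 hi with rfl | hi
        · exact ⟨fun h => absurd h hnS, fun _ => hnz⟩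
        · rw [← hmem i hi]; exact hzS i hi)
  refine ⟨φ, hφ, fun j σ hσ hcard S hS => ?_⟩
  obtain ⟨t, -, ht⟩ := hG j σ hσ (Finset.card_image_le.trans hcard) S (Finset.mem_powerset.2 hS)
  exact ⟨t, ht⟩

theorem exists_subseq_hasSpreadingModel_ellOneBasis {K : Type*} [MetricSpace K] [CompactSpace K]
    {f : ℕ → C(K, ℝ)} {F : K → ℝ} {M : ℝ}
    (hM : ∀ n, ‖f n‖ ≤ M) (hlim : PointwiseLimit f F) (hF : F ∉ BHalf K) :
    ∃ φ : ℕ → ℕ, StrictMono φ ∧ HasSpreadingModelEquivTo (fun n => f (φ n)) ellOneBasis := by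
  have hM0 : 0 ≤ M := (norm_nonneg _).trans (hM 0)
  obtain ⟨r, s, hrs, hne⟩ : ∃ r s, r < s ∧ ∀ n, (oscDeriv F r s n).Nonempty := by
    by_contra! h
    exact hF (mem_BHalf_of_oscDeriv_eq_empty ⟨f, ⟨M, hM⟩, hlim⟩ (M := M)
      (fun t => le_of_tendsto (hlim t).abs
        (Eventually.of_forall fun n => ((f n).norm_coe_le_norm t).trans (hM n))) h)
  have hFc : ¬ Continuous F := by
    intro hc
    obtain ⟨t, ht1, ht2⟩ := hne 1
    have h1 : s ≤ F t := closure_minimal (fun y hy => hy.2) (isClosed_le continuous_const hc) ht1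
    have h2 : F t ≤ r := closure_minimal (fun y hy => hy.2) (isClosed_le hc continuous_const) ht2
    linarith
  obtain ⟨r', hr, hr's⟩ := exists_between hrs
  obtain ⟨s', hrs', hs⟩ := exists_between hr's
  obtain ⟨φ, hφ, hind⟩ := exists_subseq_independent hlim hr hs hne
  have hlower : ∀ k, ∀ n : ℕ → ℕ, StrictMono n → (∀ i, k ≤ n i) → ∀ a : ℕ → ℝ,
      ∑ i ∈ Finset.range k, |a i| ≤
        2 / (s' - r') * ‖∑ i ∈ Finset.range k, a i • f (φ (n i))‖ := by
    intro k n hn hkn a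
    set x := ∑ i ∈ Finset.range k, a i • f (φ (n i)) with hx
    have hxt : ∀ t, x t = ∑ i ∈ Finset.range k, a i * f (φ (n i)) t := fun t => by
      simp [hx, ContinuousMap.coe_sum]
    have himg : ((Finset.range k).image n).image φ = (Finset.range k).image (φ ∘ n) :=
      Finset.image_image
    have hinj : Function.Injective (φ ∘ n) := (hφ.comp hn).injective
    -- points at which the terms are large exactly where the coefficients satisfy `p`
    have hpt : ∀ p : ℕ → Prop, ∃ t, ∀ i ∈ Finset.range k,
        (p i → s' < f (φ (n i)) t) ∧ (¬ p i → f (φ (n i)) t < r') := by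
      classical
      intro p
      obtain ⟨t, ht⟩ := hind k ((Finset.range k).image n) (by simpa using fun i _ => hkn i)
        (Finset.card_image_le.trans (by simp)) (((Finset.range k).filter p).image (φ ∘ n))
        (by rw [himg]; exact Finset.image_subset_image (Finset.filter_subset _ _))
      refine ⟨t, fun i hi => ?_⟩
      have h1 := ht ((φ ∘ n) i) (by rw [himg]; exact Finset.mem_image_of_mem _ hi)
      rw [hinj.mem_finset_image, Finset.mem_filter] at h1
      exact ⟨fun h => h1.1 ⟨hi, h⟩, fun h => h1.2 fun h' => h h'.2⟩
    obtain ⟨y, hy⟩ := hpt fun i => 0 ≤ a i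
    obtain ⟨z, hz⟩ := hpt fun i => ¬ 0 ≤ a i
    have hterm : ∀ i ∈ Finset.range k, (s' - r') * |a i| ≤
        a i * f (φ (n i)) y - a i * f (φ (n i)) z := by
      intro i hi
      rcases le_or_gt 0 (a i) with h | h
      · have h1 := (hy i hi).1 h
        have h2 := (hz i hi).2 (not_not.2 h)
        rw [abs_of_nonneg h]
        nlinarith
      · have h1 := (hy i hi).2 (not_le.2 h)
        have h2 := (hz i hi).1 (not_le.2 h)
        rw [abs_of_neg h]
        nlinarith
    have hsum := Finset.sum_le_sum hterm
    rw [← Finset.mul_sum, Finset.sum_sub_distrib, ← hxt, ← hxt] at hsum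
    have h1 := abs_le.1 (x.norm_coe_le_norm y)
    have h2 := abs_le.1 (x.norm_coe_le_norm z)
    rw [div_mul_eq_mul_div, le_div_iff₀ (by linarith)]
    linarith [h1.2, h2.1]
  have hupper : ∀ k, ∀ n : ℕ → ℕ, ∀ a : ℕ → ℝ,
      ‖∑ i ∈ Finset.range k, a i • f (φ (n i))‖ ≤ M * ∑ i ∈ Finset.range k, |a i| := by
    intro k n a
    refine (norm_sum_le _ _).trans ?_
    rw [Finset.mul_sum]
    refine Finset.sum_le_sum fun i _ => ?_
    rw [norm_smul, mul_comm, Real.norm_eq_abs]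
    exact mul_le_mul_of_nonneg_right (hM _) (abs_nonneg _)
  have hpos : 0 < 2 / (s' - r') := div_pos two_pos (by linarith)
  obtain ⟨θ, hθ, hmodel⟩ := exists_subseq_hasSpreadingModelEquivTo (f := fun n => f (φ n))
    (fun n => hM _) (fun t => (hlim t).comp hφ.tendsto_atTop) hFc ellOneBasis_ne_zero
    (fun m n hmn a => by
      rw [norm_sum_ellOneBasis, norm_sum_ellOneBasis]
      exact Finset.sum_le_sum_of_subset_of_nonneg (Finset.range_subset_range.2 hmn)
        fun _ _ _ => abs_nonneg _)
    (D := max M (2 / (s' - r'))) (lt_max_of_lt_right hpos) (fun k => ⟨k, fun n hn hkn a => by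
      rw [norm_sum_ellOneBasis]
      exact ⟨(hupper k n a).trans (mul_le_mul_of_nonneg_right (le_max_left _ _)
          (Finset.sum_nonneg fun _ _ => abs_nonneg _)),
        (hlower k n hn hkn a).trans
          (mul_le_mul_of_nonneg_right (le_max_right _ _) (norm_nonneg _))⟩⟩)
  exact ⟨φ ∘ θ, hφ.comp hθ, hmodel⟩

end EllOne

end BaireSub

theorem theoremB {K : Type*} [MetricSpace K] [CompactSpace K]
    (f : ℕ → C(K, ℝ)) (F : K → ℝ)
    (hbdd : BaireSub.UniformlyBounded f) (hlim : BaireSub.PointwiseLimit f F) :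
    (F ∉ BaireSub.BHalf K →
      ∃ φ : ℕ → ℕ, StrictMono φ ∧
        BaireSub.HasSpreadingModelEquivTo (fun n => f (φ n)) BaireSub.ellOneBasis) ∧
    (F ∈ BaireSub.BQuarter K → ¬ Continuous F →
      ∃ g : ℕ → C(K, ℝ), BaireSub.IsConvexBlockSubseq g f ∧
        BaireSub.HasSpreadingModelEquivTo g BaireSub.summingBasis) := by
  obtain ⟨M, hM⟩ := hbdd
  exact ⟨BaireSub.exists_subseq_hasSpreadingModel_ellOneBasis hM hlim,
    BaireSub.exists_convexBlock_hasSpreadingModel_summingBasis hM hlim⟩
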